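/- Let $p$ be an odd prime with $p\equiv 2\pmod 3$, let $k=\overline{\mathbb F}_p$, let $\zeta_6\in k$ be a primitive sixth root of unity and put $\zeta_3=\zeta_6^2$. Let $C$ be the smooth projective curve over $k$ with affine equation $y^2=x^6+1$, let $\infty_+,\infty_-$ be its two points at infinity, and identify $\mathrm{Jac}(C)$ (its group of $k$-points) with the group of degree-zero divisor classes of $C$. Let $E$ be the elliptic curve $y^2=x^3+1$, with $p$-power Frobenius $\pi_E$ and automorphism $\rho_3(x,y)=(\zeta_3x,y)$. Let $f,f':C\to E$ be the morphisms $f(x,y)=(x^2,y)$ and $f'(x,y)=(1/x^2,\,y/x^3)$. Let $\pi_C,\chi,\rho_6$ be the endomorphisms of $\mathrm{Jac}(C)$ induced (by push-forward of divisors) by the $p$-power Frobenius of $C$, by $(x,y)\mapsto(1/x,\,y/x^3)$ and by $(x,y)\mapsto(\zeta_6x,y)$, respectively. Then the maps $$\mu:E\times E\to\mathrm{Jac}(C),\quad (P,Q)\mapsto\big[f^*(P)+f'^*(Q)-2(\infty_++\infty_-)\big],$$ $$\tilde\mu:\mathrm{Jac}(C)\to E\times E,\quad \Big[\sum_i n_iP_i\Big]\mapsto\Big(\sum_i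 n_if(P_i),\ \sum_i n_if'(P_i)\Big)$$ and $\pi_C,\chi,\rho_6$ are well-defined homomorphisms, and with $T(\psi)=\tilde\mu\circ\psi\circ\mu$ for endomorphisms $\psi$ of $\mathrm{Jac}(C)$ one has, in $\mathrm{End}(E\times E)=M_2(\mathrm{End}(E))$, $$T(\pi_C)=2\begin{pmatrix}\pi_E&0\\0&\pi_E\end{pmatrix},\qquad T(\chi)=2\begin{pmatrix}0&1\\1&0\end{pmatrix},\qquad T(\rho_6)=2\begin{pmatrix}\rho_3&0\\0&-\rho_3^2\end{pmatrix}.$$ -/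

import Mathlib

open Polynomial

noncomputable section

namespace SexticJacobian

/-- An algebraic closure of the prime field `𝔽_p`. -/
abbrev Fbar (p : ℕ) [Fact p.Prime] : Type := AlgebraicClosure (ZMod p)

instance instDecidableEqFbar (p : ℕ) [Fact p.Prime] : DecidableEq (Fbar p) := Classical.decEq _

theorem two_ne_zero_Fbar (p : ℕ) [Fact p.Prime] [h : Fact (p ≠ 2)] : (2 : Fbar p) ≠ 0 := by
  intro h2
  have h3 : ((2 : ℕ) : Fbar p) = 0 := by exact_mod_cast h2
  rw [CharP.cast_eq_zero_iff (Fbar p) p] at h3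
  exact h.out ((Nat.prime_dvd_prime_iff_eq Fact.out Nat.prime_two).mp h3)

theorem three_ne_zero_Fbar (p : ℕ) [Fact p.Prime] [h : Fact (p % 3 = 2)] : (3 : Fbar p) ≠ 0 := by
  intro h2
  have h3 : ((3 : ℕ) : Fbar p) = 0 := by exact_mod_cast h2
  rw [CharP.cast_eq_zero_iff (Fbar p) p] at h3
  have h4 := (Nat.prime_dvd_prime_iff_eq Fact.out Nat.prime_three).mp h3
  have h5 := h.out
  rw [h4] at h5
  norm_num at h5

/-! ### The elliptic curve `E : y² = x³ + 1` -/

/-- The Weierstrass curve `y² = x³ + 1` over `𝔽_p`. -/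
def E (p : ℕ) [Fact p.Prime] : WeierstrassCurve (ZMod p) := ⟨0, 0, 0, 0, 1⟩

/-- The group `E(𝔽̄_p)`. -/
abbrev EPoint (p : ℕ) [Fact p.Prime] : Type := ((E p).baseChange (Fbar p)).toAffine.Point

theorem E_equation_iff {p : ℕ} [Fact p.Prime] (X Y : Fbar p) :
    ((E p).baseChange (Fbar p)).toAffine.Equation X Y ↔ Y ^ 2 = X ^ 3 + 1 := by
  rw [WeierstrassCurve.Affine.equation_iff]
  simp [E, WeierstrassCurve.baseChange, WeierstrassCurve.map]

section

variable {p : ℕ} [Fact p.Prime] [Fact (p ≠ 2)] [Fact (p % 3 = 2)]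

theorem E_nonsingular {X Y : Fbar p} (h : Y ^ 2 = X ^ 3 + 1) :
    ((E p).baseChange (Fbar p)).toAffine.Nonsingular X Y := by
  rw [WeierstrassCurve.Affine.nonsingular_iff]
  refine ⟨(E_equation_iff X Y).2 h, ?_⟩
  simp only [E, WeierstrassCurve.baseChange, WeierstrassCurve.map, map_zero, map_one]
  by_contra hc
  push Not at hc
  obtain ⟨h1, h2⟩ := hc
  have hX : X = 0 := by
    have : (3 : Fbar p) * X ^ 2 = 0 := by linear_combination -h1
    simpa [three_ne_zero_Fbar p] using this
  have hY : Y = 0 := by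
    have : (2 : Fbar p) * Y = 0 := by linear_combination h2
    simpa [two_ne_zero_Fbar p] using this
  rw [hX, hY] at h
  norm_num at h

/-- The affine point `(X, Y)` of `E`. -/
def ePoint (X Y : Fbar p) (h : Y ^ 2 = X ^ 3 + 1) : EPoint p :=
  WeierstrassCurve.Affine.Point.some X Y (E_nonsingular h)

end

/-- The `p`-power Frobenius endomorphism `(X, Y) ↦ (X ^ p, Y ^ p)` of `E`
(`frobeniusAlgHom` raises to the power `Fintype.card (ZMod p) = p`). -/
def piE (p : ℕ) [Fact p.Prime] : AddMonoid.End (EPoint p) :=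
  WeierstrassCurve.Affine.Point.map (W' := E p) (FiniteField.frobeniusAlgHom (ZMod p) (Fbar p))

/-- The automorphism `(X, Y) ↦ (z X, Y)` of `E`, for a cube root of unity `z`. -/
def rho3 (p : ℕ) [Fact p.Prime] [Fact (p ≠ 2)] [Fact (p % 3 = 2)] (z : Fbar p) (hz : z ^ 3 = 1) :
    AddMonoid.End (EPoint p) where
  toFun P := match P with
    | .zero => 0
    | .some X Y h => ePoint (z * X) Y
        (by rw [mul_pow, hz, one_mul]; exact (E_equation_iff X Y).1 h.1)
  map_zero' := rfl
  map_add' := by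
    have hz0 : z ≠ 0 := by rintro rfl; norm_num at hz
    rintro (_ | ⟨x₁, y₁, h₁⟩) (_ | ⟨x₂, y₂, h₂⟩)
    any_goals rfl
    have hneg : ∀ x y : Fbar p, ((E p).baseChange (Fbar p)).toAffine.negY x y = -y := by
      intro x y
      simp [E, WeierstrassCurve.baseChange, WeierstrassCurve.map, WeierstrassCurve.Affine.negY]
    by_cases hxy : x₁ = x₂ ∧ y₁ = ((E p).baseChange (Fbar p)).toAffine.negY x₂ y₂
    · rw [WeierstrassCurve.Affine.Point.add_of_Y_eq hxy.1 hxy.2]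
      refine (WeierstrassCurve.Affine.Point.add_of_Y_eq (by rw [hxy.1]) ?_).symm
      rw [hneg]; rw [hneg] at hxy; exact hxy.2
    · have hxy' : ¬ (z * x₁ = z * x₂ ∧
          y₁ = ((E p).baseChange (Fbar p)).toAffine.negY (z * x₂) y₂) := by
        rintro ⟨ha, hb⟩
        rw [hneg] at hb
        exact hxy ⟨mul_left_cancel₀ hz0 ha, by rw [hneg]; exact hb⟩
      rw [WeierstrassCurve.Affine.Point.add_some hxy]
      refine Eq.trans ?_ (WeierstrassCurve.Affine.Point.add_some hxy').symm
      have hs : ((E p).baseChange (Fbar p)).toAffine.slope (z * x₁) (z * x₂) y₁ y₂ =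
          z⁻¹ * ((E p).baseChange (Fbar p)).toAffine.slope x₁ x₂ y₁ y₂ := by
        by_cases hx : x₁ = x₂
        · subst hx
          have hy : y₁ ≠ ((E p).baseChange (Fbar p)).toAffine.negY x₁ y₂ := fun h => hxy ⟨rfl, h⟩
          have hy' : y₁ ≠ ((E p).baseChange (Fbar p)).toAffine.negY (z * x₁) y₂ :=
            fun h => hxy' ⟨rfl, h⟩
          rw [WeierstrassCurve.Affine.slope_of_Y_ne rfl hy,
            WeierstrassCurve.Affine.slope_of_Y_ne rfl hy', hneg, hneg]
          simp only [E, WeierstrassCurve.baseChange, WeierstrassCurve.map, map_zero]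
          have : z ^ 2 = z⁻¹ := by
            exact eq_inv_of_mul_eq_one_left (by linear_combination hz)
          rw [← this]; ring
        · rw [WeierstrassCurve.Affine.slope_of_X_ne hx, WeierstrassCurve.Affine.slope_of_X_ne
            (fun h => hx (mul_left_cancel₀ hz0 h)), ← mul_sub, div_mul_eq_div_div_swap,
            div_eq_inv_mul (_ / _)]
      have hi : (z⁻¹) ^ 2 = z := by
        have : z⁻¹ = z ^ 2 := by
          exact (eq_inv_of_mul_eq_one_left (by linear_combination hz)).symm
        rw [this]; linear_combination z * hz
      have hX : ∀ l, ((E p).baseChange (Fbar p)).toAffine.addX (z * x₁) (z * x₂) (z⁻¹ * l) =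
          z * ((E p).baseChange (Fbar p)).toAffine.addX x₁ x₂ l := by
        intro l
        simp only [E, WeierstrassCurve.baseChange, WeierstrassCurve.map, map_zero,
          WeierstrassCurve.Affine.addX]
        linear_combination l ^ 2 * hi
      have hY : ∀ l, ((E p).baseChange (Fbar p)).toAffine.addY (z * x₁) (z * x₂) y₁ (z⁻¹ * l) =
          ((E p).baseChange (Fbar p)).toAffine.addY x₁ x₂ y₁ l := by
        intro l
        simp only [WeierstrassCurve.Affine.addY, hneg, WeierstrassCurve.Affine.negAddY, hX]
        have : z⁻¹ * z = 1 := inv_mul_cancel₀ hz0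
        linear_combination (-l * (((E p).baseChange (Fbar p)).toAffine.addX x₁ x₂ l - x₁)) * this
      simp only [ePoint, hs, hX, hY]

theorem cube_sq_eq_one {p : ℕ} [Fact p.Prime] {ζ : Fbar p} (hζ : IsPrimitiveRoot ζ 6) :
    (ζ ^ 2) ^ 3 = 1 := by
  rw [← pow_mul]
  exact hζ.pow_eq_one

/-- The endomorphism of `A × A` given by a `2 × 2` matrix of endomorphisms of `A`, acting on
column vectors. -/
def matrixEnd {A : Type*} [AddCommGroup A] (M : Matrix (Fin 2) (Fin 2) (AddMonoid.End A)) :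
    AddMonoid.End (A × A) :=
  AddMonoidHom.prod
    (AddMonoidHom.coprod (M 0 0) (M 0 1))
    (AddMonoidHom.coprod (M 1 0) (M 1 1))

/-! ### The curve `C : y² = x⁶ + 1` -/

/-- The points over `𝔽̄_p` of the smooth projective curve `C` with affine equation `y² = x⁶ + 1`:
it is glued from the two charts `y² = x⁶ + 1` and `s² = 1 + t⁶` by `t = 1 / x`, `s = y / x³`, so
there are two points at infinity, at which `t = 0` and `s = ±1`. -/
inductive CPoint (p : ℕ) [Fact p.Prime] : Type
  | affine (a b : Fbar p) (h : b ^ 2 = a ^ 6 + 1) : CPoint p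
  | infty (s : Fbar p) (h : s ^ 2 = 1) : CPoint p

/-- The affine coordinate ring `𝔽̄_p[x, y] / (y² - (x⁶ + 1))` of `C`. -/
abbrev CoordRing (p : ℕ) [Fact p.Prime] : Type :=
  AdjoinRoot (X ^ 2 - C (X ^ 6 + 1) : (Fbar p)[X][X])

section

variable (p : ℕ) [Fact p.Prime] [Fact (p ≠ 2)] [Fact (p % 3 = 2)]

theorem irreducible_curve : Irreducible (X ^ 2 - C (X ^ 6 + 1) : (Fbar p)[X][X]) := by
  have hm : (X ^ 2 - C (X ^ 6 + 1) : (Fbar p)[X][X]).Monic := monic_X_pow_sub_C _ two_ne_zero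
  have hd : (X ^ 2 - C (X ^ 6 + 1) : (Fbar p)[X][X]).natDegree = 2 := natDegree_X_pow_sub_C
  by_contra h
  obtain ⟨f, g, h0, h1⟩ := (hm.not_irreducible_iff_exists_add_mul_eq_coeff hd).mp h
  have h0' : f * g = -(X ^ 6 + 1) := by
    rw [← h0, coeff_sub, coeff_C_zero, coeff_X_pow]; simp
  have h1' : f + g = 0 := by
    rw [← h1, coeff_sub, coeff_C_of_ne_zero one_ne_zero, coeff_X_pow]; simp
  have hf : f * f = X ^ 6 + 1 := by linear_combination f * h1' - h0'
  have h6 : ((6 : ℕ) : Fbar p) ≠ 0 := by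
    have : ((6 : ℕ) : Fbar p) = 2 * 3 := by norm_num
    rw [this]
    exact mul_ne_zero (two_ne_zero_Fbar p) (three_ne_zero_Fbar p)
  have hs : (X ^ 6 - C (-1) : (Fbar p)[X]).Separable := separable_X_pow_sub_C _ h6 (by simp)
  have hu : IsUnit f := hs.squarefree f ⟨1, by rw [hf]; simp⟩
  have h3 : (X ^ 6 - C (-1) : (Fbar p)[X]).natDegree = 6 := natDegree_X_pow_sub_C
  have h4 : (X ^ 6 - C (-1) : (Fbar p)[X]) = f * f := by rw [hf]; simp
  rw [h4, natDegree_mul hu.ne_zero hu.ne_zero, natDegree_eq_zero_of_isUnit hu] at h3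
  norm_num at h3

instance instIsDomainCoordRing : IsDomain (CoordRing p) :=
  AdjoinRoot.isDomain_of_prime (irreducible_curve p).prime

/-- The function field of `C` over `𝔽̄_p`. -/
abbrev FunctionField : Type := FractionRing (CoordRing p)

/-- The coordinate function `x` on `C`. -/
def xFun : FunctionField p := algebraMap (CoordRing p) _ (AdjoinRoot.of _ X)

/-- The coordinate function `y` on `C`. -/
def yFun : FunctionField p := algebraMap (CoordRing p) _ (AdjoinRoot.root _)

/-- The chart coordinates at a point: `(x, y)` at an affine point and `(1 / x, y / x³)` at a point
at infinity. -/
def chart : CPoint p → Fin 2 → FunctionField p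
  | .affine _ _ _ => ![xFun p, yFun p]
  | .infty _ _ => ![(xFun p)⁻¹, yFun p / xFun p ^ 3]

/-- The values at a point of the chart coordinates at this point. -/
def chartValue : CPoint p → Fin 2 → Fbar p
  | .affine a b _ => ![a, b]
  | .infty s _ => ![0, s]

variable {p}

/-- `u` is a unit of the local ring of `C` at `P`: a quotient of two polynomials in the chart
coordinates, neither of which vanishes at `P`. -/
def IsUnitAt (P : CPoint p) (u : FunctionField p) : Prop :=
  ∃ g h : MvPolynomial (Fin 2) (Fbar p),
    MvPolynomial.eval (chartValue p P) g ≠ 0 ∧ MvPolynomial.eval (chartValue p P) h ≠ 0 ∧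
      u = MvPolynomial.aeval (chart p P) g / MvPolynomial.aeval (chart p P) h

/-- A uniformizer of the local ring of `C` at a point. -/
def uniformizer : CPoint p → FunctionField p
  | .affine a b _ => if b = 0 then yFun p else xFun p - algebraMap (Fbar p) _ a
  | .infty _ _ => (xFun p)⁻¹

/-- The function `φ` has order `n` at `P`, i.e. `φ = tⁿ u` with `t` a uniformizer and `u` a unit of
the local ring at `P`. -/
def HasOrd (P : CPoint p) (φ : FunctionField p) (n : ℤ) : Prop :=
  ∃ u, IsUnitAt P u ∧ φ = uniformizer P ^ n * u

/-! ### Divisors and the Jacobian -/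

variable (p)

/-- Divisors on `C`. -/
abbrev Divisor : Type := CPoint p →₀ ℤ

/-- The degree of a divisor. -/
def degree : Divisor p →+ ℤ := Finsupp.liftAddHom fun _ => AddMonoidHom.id ℤ

/-- Divisors of degree zero. -/
abbrev DivisorZero : AddSubgroup (Divisor p) := (degree p).ker

variable {p}

theorem IsUnitAt.one (P : CPoint p) : IsUnitAt P 1 := ⟨1, 1, by simp, by simp, by simp⟩

theorem IsUnitAt.mul {P : CPoint p} {u v : FunctionField p} (hu : IsUnitAt P u)
    (hv : IsUnitAt P v) : IsUnitAt P (u * v) := by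
  obtain ⟨g, h, hg, hh, rfl⟩ := hu
  obtain ⟨g', h', hg', hh', rfl⟩ := hv
  exact ⟨g * g', h * h', by simpa using ⟨hg, hg'⟩, by simpa using ⟨hh, hh'⟩, by
    rw [map_mul, map_mul, div_mul_div_comm]⟩

theorem IsUnitAt.inv {P : CPoint p} {u : FunctionField p} (hu : IsUnitAt P u) :
    IsUnitAt P u⁻¹ := by
  obtain ⟨g, h, hg, hh, rfl⟩ := hu
  exact ⟨h, g, hh, hg, by rw [inv_div]⟩

theorem of_ne_zero {g : (Fbar p)[X]} (hg : g ≠ 0) :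
    algebraMap (CoordRing p) (FunctionField p) (AdjoinRoot.of _ g) ≠ 0 := by
  have h1 : AdjoinRoot.of (X ^ 2 - C (X ^ 6 + 1) : (Fbar p)[X][X]) g ≠ 0 := by
    intro h
    refine hg (AdjoinRoot.of.injective_of_degree_ne_zero ?_ (h.trans (map_zero _).symm))
    rw [degree_X_pow_sub_C two_pos]
    norm_num
  intro h
  exact h1 (IsFractionRing.injective (CoordRing p) (FunctionField p) (h.trans (map_zero _).symm))

theorem xFun_ne_algebraMap (a : Fbar p) : xFun p ≠ algebraMap (Fbar p) _ a := by
  intro h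
  refine of_ne_zero (X_sub_C_ne_zero a) ?_
  rw [map_sub, map_sub]
  exact sub_eq_zero.2 h

theorem yFun_sq : yFun p ^ 2 = xFun p ^ 6 + 1 := by
  have h := AdjoinRoot.eval₂_root (X ^ 2 - C (X ^ 6 + 1) : (Fbar p)[X][X])
  rw [eval₂_sub, eval₂_pow, eval₂_X, eval₂_C, sub_eq_zero] at h
  rw [yFun, ← map_pow, h, xFun]
  simp only [map_add, map_pow, map_one]

theorem yFun_ne_zero : yFun p ≠ 0 := by
  intro h
  have h2 := yFun_sq (p := p)
  refine of_ne_zero (p := p) (g := X ^ 6 - C (-1)) (X_pow_sub_C_ne_zero (by norm_num) _) ?_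
  rw [h] at h2
  simpa [xFun] using h2.symm

theorem uniformizer_ne_zero (P : CPoint p) : uniformizer P ≠ 0 := by
  cases P with
  | affine a b h =>
    rw [uniformizer]
    split_ifs
    · exact yFun_ne_zero
    · exact sub_ne_zero.2 (xFun_ne_algebraMap a)
  | infty s h =>
    exact inv_ne_zero (by simpa using xFun_ne_algebraMap (p := p) 0)

variable (p)

/-- Principal divisors: the divisors of the nonzero functions on `C`. -/
def Principal : AddSubgroup (Divisor p) where
  carrier := {D | ∃ φ : FunctionField p, φ ≠ 0 ∧ ∀ P, HasOrd P φ (D P)}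
  zero_mem' := ⟨1, one_ne_zero, fun P => ⟨1, IsUnitAt.one P, by simp⟩⟩
  add_mem' := by
    rintro D D' ⟨φ, hφ, h⟩ ⟨ψ, hψ, h'⟩
    refine ⟨φ * ψ, mul_ne_zero hφ hψ, fun P => ?_⟩
    obtain ⟨u, hu, e⟩ := h P
    obtain ⟨v, hv, e'⟩ := h' P
    refine ⟨u * v, hu.mul hv, ?_⟩
    rw [e, e', Finsupp.add_apply, zpow_add₀ (uniformizer_ne_zero P)]
    ring
  neg_mem' := by
    rintro D ⟨φ, hφ, h⟩
    refine ⟨φ⁻¹, inv_ne_zero hφ, fun P => ?_⟩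
    obtain ⟨u, hu, e⟩ := h P
    refine ⟨u⁻¹, hu.inv, ?_⟩
    rw [e, Finsupp.neg_apply, zpow_neg, mul_inv]

/-- The Jacobian of `C` (its group of points over `𝔽̄_p`): the group of classes of divisors of
degree zero modulo principal divisors. -/
abbrev Jac : Type := DivisorZero p ⧸ (Principal p).addSubgroupOf (DivisorZero p)

variable {p}

/-- The homomorphism induced on `Jac(C)` by a homomorphism `F` on divisors of degree zero that kills
principal divisors (and `0` if `F` does not; that this does not happen for the maps `F` used here is
part of the theorem). -/
def induced {G : Type*} [AddCommGroup G] (F : DivisorZero p →+ G) : Jac p →+ G :=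
  open Classical in
  if h : (Principal p).addSubgroupOf (DivisorZero p) ≤ F.ker then QuotientAddGroup.lift _ F h else 0

/-- The divisor class of a divisor of degree zero (and `0` for other divisors). -/
def divisorClass (D : Divisor p) : Jac p :=
  open Classical in
  if h : D ∈ DivisorZero p then QuotientAddGroup.mk ⟨D, h⟩ else 0

/-- The push-forward of divisors of degree zero by a map `α : C → C`:
`∑ n_P P ↦ ∑ n_P α(P)`. -/
def pushDivisor (α : CPoint p → CPoint p) : DivisorZero p →+ DivisorZero p :=
  ((Finsupp.mapDomain.addMonoidHom α).comp (DivisorZero p).subtype).codRestrict (DivisorZero p) (by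
    rintro ⟨D, hD⟩
    rw [AddMonoidHom.mem_ker] at hD ⊢
    rw [← hD]
    simp [degree, Finsupp.sum_mapDomain_index]
    rfl)

/-- The endomorphism of `Jac(C)` induced by a map `α : C → C`. -/
def inducedEnd (α : CPoint p → CPoint p) : AddMonoid.End (Jac p) :=
  induced ((QuotientAddGroup.mk' _).comp (pushDivisor α))

/-! ### The endomorphisms `π_C`, `χ` and `ρ₆` -/

variable (p)

/-- The `p`-power Frobenius map of `C`. -/
def frobC : CPoint p → CPoint p
  | .affine a b h => .affine (a ^ p) (b ^ p) (by
      rw [← pow_mul, mul_comm p 2, pow_mul, h, add_pow_char, one_pow, ← pow_mul, ← pow_mul,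
        mul_comm 6 p])
  | .infty s h => .infty (s ^ p) (by rw [← pow_mul, mul_comm p 2, pow_mul, h, one_pow])

/-- The automorphism `(x, y) ↦ (1 / x, y / x³)` of `C`. -/
def chiC : CPoint p → CPoint p
  | .affine a b h =>
    if ha : a = 0 then .infty b (by rw [h, ha]; norm_num)
    else .affine (1 / a) (b / a ^ 3) (by rw [div_pow, h]; field_simp; ring)
  | .infty s h => .affine 0 s (by rw [h]; norm_num)

variable {p}

/-- The automorphism `(x, y) ↦ (ζ x, y)` of `C`, for a sixth root of unity `ζ`. -/
def rhoC (ζ : Fbar p) (hζ : ζ ^ 6 = 1) : CPoint p → CPoint p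
  | .affine a b h => .affine (ζ * a) b (by rw [mul_pow, hζ, one_mul, h])
  | .infty s h => .infty (s / ζ ^ 3) (by rw [div_pow, h, ← pow_mul, hζ, div_one])

variable (p)

/-- The Frobenius endomorphism of `Jac(C)`. -/
def piJac : AddMonoid.End (Jac p) := inducedEnd (frobC p)

/-- The endomorphism of `Jac(C)` induced by `(x, y) ↦ (1 / x, y / x³)`. -/
def chiJac : AddMonoid.End (Jac p) := inducedEnd (chiC p)

variable {p}

/-- The endomorphism of `Jac(C)` induced by `(x, y) ↦ (ζ x, y)`. -/
def rho6Jac (ζ : Fbar p) (hζ : ζ ^ 6 = 1) : AddMonoid.End (Jac p) := inducedEnd (rhoC ζ hζ)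

/-! ### The morphisms `f, f' : C → E` -/

variable (p)

/-- The morphism `f : C → E`, `(x, y) ↦ (x², y)`. -/
def fMap : CPoint p → EPoint p
  | .affine a b h => ePoint (a ^ 2) b (by rw [h]; ring)
  | .infty _ _ => 0

/-- The morphism `f' : C → E`, `(x, y) ↦ (1 / x², y / x³)`. -/
def fMap' : CPoint p → EPoint p
  | .affine a b h =>
    if ha : a = 0 then 0
    else ePoint (1 / a ^ 2) (b / a ^ 3) (by rw [div_pow, h]; field_simp; ring)
  | .infty s h => ePoint 0 s (by rw [h]; norm_num)

variable {p}

/-- The composition with `(U, V) : C → E` of a uniformizer of the local ring of `E` at `P`. The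
uniformizer is `X / Y` at the origin, and `Y` or `X - X₀` at an affine point `(X₀, Y₀)`, according
to whether `Y₀ = 0` or not. -/
def uniformizerE (U V : FunctionField p) : EPoint p → FunctionField p
  | .zero => U / V
  | .some X₀ Y₀ _ => if Y₀ = 0 then V else U - algebraMap (Fbar p) _ X₀

/-- `D` is the pull-back of the point `P` by the morphism `g = (U, V) : C → E`, i.e. the fibre
`g⁻¹(P)`, each point `Q` of it counted with its ramification index, which is the order at `Q` of
the composition with `g` of a uniformizer at `P`. -/
def IsPullback (g : CPoint p → EPoint p) (U V : FunctionField p) (P : EPoint p)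
    (D : Divisor p) : Prop :=
  ∀ Q, (g Q = P → HasOrd Q (uniformizerE U V P) (D Q)) ∧ (g Q ≠ P → D Q = 0)

/-- The pull-back of the point `P` by the morphism `g = (U, V) : C → E`. -/
def pullback (g : CPoint p → EPoint p) (U V : FunctionField p) (P : EPoint p) : Divisor p :=
  open Classical in
  if h : ∃ D, IsPullback g U V P D then h.choose else 0

/-- The pull-back `f^*(P)`. -/
def fPull (P : EPoint p) : Divisor p := pullback (fMap p) (xFun p ^ 2) (yFun p) P

/-- The pull-back `f'^*(P)`. -/
def fPull' (P : EPoint p) : Divisor p :=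
  pullback (fMap' p) (1 / xFun p ^ 2) (yFun p / xFun p ^ 3) P

/-! ### The homomorphisms `μ`, `μ̃` and `T` -/

variable (p)

/-- The sum of the two points at infinity of `C`. -/
def divInfty : Divisor p :=
  Finsupp.single (.infty 1 (one_pow 2)) 1 + Finsupp.single (.infty (-1) neg_one_sq) 1

variable {p}

/-- The divisor `f^*(P) + f'^*(Q) - 2 (∞₊ + ∞₋)`. -/
def muDivisor (R : EPoint p × EPoint p) : Divisor p :=
  fPull R.1 + fPull' R.2 - 2 • divInfty p

variable (p)

/-- The homomorphism `μ : E × E → Jac(C)`, `(P, Q) ↦ [f^*(P) + f'^*(Q) - 2 (∞₊ + ∞₋)]`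
(that this formula is additive, so that the value `0` of the other case is not taken, is part of the
theorem). -/
def mu : EPoint p × EPoint p →+ Jac p :=
  open Classical in
  if h : ∀ R S : EPoint p × EPoint p,
      divisorClass (muDivisor (R + S)) = divisorClass (muDivisor R) + divisorClass (muDivisor S)
  then AddMonoidHom.mk' (fun R => divisorClass (muDivisor R)) h else 0

/-- The homomorphism `∑ n_P P ↦ (∑ n_P f(P), ∑ n_P f'(P))` on divisors of degree zero. -/
def muTildeDivisor : DivisorZero p →+ EPoint p × EPoint p :=
  (AddMonoidHom.prod
    (Finsupp.liftAddHom fun P => (zmultiplesHom (EPoint p)) (fMap p P))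
    (Finsupp.liftAddHom fun P => (zmultiplesHom (EPoint p)) (fMap' p P))).comp
    (DivisorZero p).subtype

/-- The homomorphism `μ̃ = (f_*, f'_*) : Jac(C) → E × E`. -/
def muTilde : Jac p →+ EPoint p × EPoint p := induced (muTildeDivisor p)

/-- The homomorphism `T : End(Jac(C)) → End(E × E)`, `ψ ↦ μ̃ ∘ ψ ∘ μ`. -/
def T : AddMonoid.End (Jac p) →+ AddMonoid.End (EPoint p × EPoint p) where
  toFun ψ := (muTilde p).comp (AddMonoidHom.comp ψ (mu p))
  map_zero' := by
    apply AddMonoidHom.ext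
    intro R
    exact (muTilde p).map_zero
  map_add' ψ ψ' := by
    apply AddMonoidHom.ext
    intro R
    exact (muTilde p).map_add _ _

end

end SexticJacobian

end

open SexticJacobian

/-!
An automorphism of `C` acts on `k(C)` preserving orders, so push-forward along it preserves
principal divisors. The map `f` identifies `k(E)` with the fixed field of `ι : (x, y) ↦ (-x, y)`,
so the push-forward of `div φ` along `f` is the divisor of the norm `φ * ι*(φ)`; and principal
divisors on `E` sum to zero because `E(k)` embeds in the class group of its coordinate ring. Hence
`f` induces a homomorphism from `Jac(C)` to `E`, and so does `f' = f ∘ χ`. Conversely `μ` is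
additive because the equations of the chords and vertical lines of `E` pull back to functions on
`C`. Finally `f^*(f(Q)) = Q + ι(Q)` and `f' ∘ ι = -f'`, so `T(α)` is twice the endomorphism of
`E × E` through which `α` acts on the values of `f` and `f'`.
-/

noncomputable section

namespace SexticJacobian

/-! ### Dedekind domains -/

section Dedekind

open FractionalIdeal nonZeroDivisors
open IsDedekindDomain (HeightOneSpectrum)

section Invertible

variable {A : Type*} [CommRing A] [IsDomain A] [IsNoetherianRing A]

theorem mul_lt_of_ne_bot_of_ne_top {I M : Ideal A} (hI : I ≠ ⊥) (hM : M ≠ ⊤) : I * M < I := by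
  refine lt_of_le_of_ne Ideal.mul_le_left fun hIM => hM ((Ideal.eq_top_iff_one M).2 ?_)
  obtain ⟨r, hrM, hrI⟩ := Submodule.exists_sub_one_mem_and_smul_eq_zero_of_fg_of_le_smul M I
    (IsNoetherian.noetherian I) (by rw [smul_eq_mul, mul_comm, hIM])
  obtain ⟨i, hi, hi0⟩ := Submodule.exists_mem_ne_zero_of_ne_bot hI
  have hr0 : r = 0 := (mul_eq_zero.1 (hrI i hi)).resolve_right hi0
  simpa [hr0] using hrM

theorem isUnit_coeIdeal_of_forall_isMaximal
    (h : ∀ M : Ideal A, M.IsMaximal → M ≠ ⊥ → IsUnit (M : FractionalIdeal A⁰ (FractionRing A)))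
    (I : Ideal A) (hI : I ≠ ⊥) : IsUnit (I : FractionalIdeal A⁰ (FractionRing A)) := by
  induction I using IsNoetherian.induction with
  | hgt I ih =>
    by_cases hItop : I = ⊤
    · rw [hItop, coeIdeal_top]
      exact isUnit_one
    obtain ⟨M, hM, hIM⟩ := Ideal.exists_le_maximal I hItop
    obtain ⟨u, hu⟩ := h M hM (ne_bot_of_le_ne_bot hI hIM)
    have hle : (I : FractionalIdeal A⁰ (FractionRing A)) * ↑u⁻¹ ≤ 1 := by
      calc (I : FractionalIdeal A⁰ (FractionRing A)) * ↑u⁻¹ ≤ M * ↑u⁻¹ :=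
            mul_le_mul_left ((coeIdeal_le_coeIdeal _).2 hIM) _
        _ = 1 := by rw [← hu, Units.mul_inv]
    obtain ⟨J, hJ⟩ := le_one_iff_exists_coeIdeal.1 hle
    have hIJ : I = J * M := by
      rw [← coeIdeal_inj (K := FractionRing A), coeIdeal_mul, hJ, ← hu, mul_assoc, Units.inv_mul,
        mul_one]
    have hJ0 : J ≠ ⊥ := fun h0 => hI (by rw [hIJ, h0, Ideal.bot_mul])
    have hlt : I < J := hIJ ▸ mul_lt_of_ne_bot_of_ne_top hJ0 hM.ne_top
    rw [hIJ, coeIdeal_mul]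
    exact (ih J hlt hJ0).mul ⟨u, hu⟩

theorem isDedekindDomain_of_forall_isMaximal_isUnit
    (h : ∀ M : Ideal A, M.IsMaximal → M ≠ ⊥ → IsUnit (M : FractionalIdeal A⁰ (FractionRing A))) :
    IsDedekindDomain A := by
  refine (isDedekindDomain_iff_mul_inv_cancel (K := FractionRing A)).2 fun I hI => ?_
  rw [mul_inv_cancel_iff_isUnit]
  obtain ⟨a, J, ha, rfl⟩ := exists_eq_spanSingleton_mul I
  have ha' : algebraMap A (FractionRing A) a ≠ 0 := by simpa using ha
  refine IsUnit.mul ?_ (isUnit_coeIdeal_of_forall_isMaximal h J ?_)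
  · refine IsUnit.of_mul_eq_one (spanSingleton A⁰ (algebraMap A (FractionRing A) a)) ?_
    rw [spanSingleton_mul_spanSingleton, inv_mul_cancel₀ ha', spanSingleton_one]
  · rintro rfl
    exact hI (by simp)

end Invertible

section Order

variable {R : Type*} [CommRing R] [IsDedekindDomain R] {K : Type*} [Field K] [Algebra R K]
  [IsFractionRing R K]

theorem eq_of_forall_count_eq {I J : FractionalIdeal R⁰ K} (hI : I ≠ 0) (hJ : J ≠ 0)
    (h : ∀ v : HeightOneSpectrum R, count K v I = count K v J) : I = J := by
  rw [← finprod_heightOneSpectrum_factorization' K hI,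
    ← finprod_heightOneSpectrum_factorization' K hJ]
  exact finprod_congr fun v => by rw [h v]

/-- The order at a prime `v` of an element of the fraction field of a Dedekind domain, with the junk
value `0` at the element `0`. -/
def ord (v : HeightOneSpectrum R) (φ : K) : ℤ := count K v (spanSingleton R⁰ φ)

variable (v : HeightOneSpectrum R)

theorem ord_mul {φ ψ : K} (hφ : φ ≠ 0) (hψ : ψ ≠ 0) : ord v (φ * ψ) = ord v φ + ord v ψ := by
  rw [ord, ← spanSingleton_mul_spanSingleton,
    count_mul _ _ (spanSingleton_ne_zero_iff.2 hφ) (spanSingleton_ne_zero_iff.2 hψ)]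
  rfl

theorem ord_div {φ ψ : K} (hφ : φ ≠ 0) (hψ : ψ ≠ 0) : ord v (φ / ψ) = ord v φ - ord v ψ := by
  rw [eq_sub_iff_add_eq, ← ord_mul v (div_ne_zero hφ hψ) hψ, div_mul_cancel₀ _ hψ]

theorem intValuation_eq_exp_neg_ord {r : R} (hr : r ≠ 0) :
    v.intValuation r = WithZero.exp (-ord v (algebraMap R K r)) := by
  rw [HeightOneSpectrum.intValuation_if_neg _ hr, ord, ← coeIdeal_span_singleton,
    count_coe _ _ (by simpa using hr)]

theorem valuation_eq_exp_neg_ord {φ : K} (hφ : φ ≠ 0) :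
    v.valuation K φ = WithZero.exp (-ord v φ) := by
  obtain ⟨r, s, -, rfl⟩ := IsFractionRing.div_surjective (A := R) φ
  obtain ⟨hr0, hs0⟩ := div_ne_zero_iff.1 hφ
  rw [map_div₀, HeightOneSpectrum.valuation_of_algebraMap,
    HeightOneSpectrum.valuation_of_algebraMap,
    intValuation_eq_exp_neg_ord (K := K) v (by simpa using hr0),
    intValuation_eq_exp_neg_ord (K := K) v (by simpa using hs0), ← WithZero.exp_sub,
    ord_div v hr0 hs0, neg_sub_neg, neg_sub]

theorem le_ord_algebraMap_iff_mem_pow {r : R} (hr : r ≠ 0) (n : ℕ) :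
    (n : ℤ) ≤ ord v (algebraMap R K r) ↔ r ∈ v.asIdeal ^ n := by
  rw [← HeightOneSpectrum.intValuation_le_pow_iff_mem, intValuation_eq_exp_neg_ord (K := K) v hr,
    WithZero.exp_le_exp, neg_le_neg_iff]

theorem exists_eq_zpow_ord_mul {t φ : K} (ht0 : t ≠ 0) (ht : ord v t = 1) (hφ : φ ≠ 0) :
    ∃ r s : R, r ∉ v.asIdeal ∧ s ∉ v.asIdeal ∧
      φ = t ^ ord v φ * (algebraMap R K r / algebraMap R K s) := by
  have hv : v.valuation K (φ / t ^ ord v φ) = 1 := by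
    rw [map_div₀, map_zpow₀, valuation_eq_exp_neg_ord v hφ, valuation_eq_exp_neg_ord v ht0, ht,
      ← WithZero.exp_zsmul, ← WithZero.exp_sub, ← WithZero.exp_zero]
    congr 1
    simp
  obtain ⟨r, s, hrs⟩ := v.exists_primeCompl_mul_eq_of_integer _ hv.le
  have hs : (s : R) ∉ v.asIdeal := s.2
  have hs0 : algebraMap R K s ≠ 0 :=
    (map_ne_zero_iff _ (IsFractionRing.injective R K)).2 fun h0 => hs (h0 ▸ Ideal.zero_mem _)
  refine ⟨r, s, (v.valuation_eq_one_iff_notMem (K := K)).1 ?_, hs, ?_⟩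
  · rw [← hrs, map_mul, hv, one_mul]
    exact (v.valuation_eq_one_iff_notMem (K := K)).2 hs
  · rw [← hrs, mul_div_cancel_right₀ _ hs0, mul_div_cancel₀ _ (zpow_ne_zero _ ht0)]

end Order

end Dedekind

/-! ### Divisors of functions on a Weierstrass curve -/

section Weierstrass

open WeierstrassCurve WeierstrassCurve.Affine FractionalIdeal nonZeroDivisors
open IsDedekindDomain (HeightOneSpectrum)

variable {F : Type*} [Field F] {W : WeierstrassCurve.Affine F}

theorem XYIdeal_isMaximal {x y : F} (h : W.Equation x y) :
    (CoordinateRing.XYIdeal W x (C y)).IsMaximal :=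
  Ideal.Quotient.maximal_of_isField _
    ((CoordinateRing.quotientXYIdealEquiv h).toMulEquiv.isField (Field.toIsField F))

theorem XClass_mem_XYIdeal (x : F) (y : F[X]) :
    CoordinateRing.XClass W x ∈ CoordinateRing.XYIdeal W x y :=
  Ideal.subset_span (by simp)

theorem YClass_mem_XYIdeal (x : F) (y : F[X]) :
    CoordinateRing.YClass W y ∈ CoordinateRing.XYIdeal W x y :=
  Ideal.subset_span (by simp)

theorem XYIdeal_ne_bot (x : F) (y : F[X]) : CoordinateRing.XYIdeal W x y ≠ ⊥ := fun h =>
  CoordinateRing.XClass_ne_zero (W' := W) x (by simpa [h] using XClass_mem_XYIdeal (W := W) x y)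

theorem XClass_sub_XClass (x x' : F) :
    CoordinateRing.XClass W x - CoordinateRing.XClass W x' =
      algebraMap F W.CoordinateRing (x' - x) := by
  rw [CoordinateRing.XClass, CoordinateRing.XClass, ← map_sub]
  change _ = CoordinateRing.mk W (C (C (x' - x)))
  simp

theorem YClass_sub_YClass (y y' : F) :
    CoordinateRing.YClass W (C y) - CoordinateRing.YClass W (C y') =
      algebraMap F W.CoordinateRing (y' - y) := by
  rw [CoordinateRing.YClass, CoordinateRing.YClass, ← map_sub]
  change _ = CoordinateRing.mk W (C (C (y' - y)))
  simp

theorem eq_and_eq_of_XYIdeal_eq {x y x' y' : F} (h : W.Equation x y)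
    (hI : CoordinateRing.XYIdeal W x (C y) = CoordinateRing.XYIdeal W x' (C y')) :
    x = x' ∧ y = y' := by
  have eq_zero_of_mem (c : F)
      (hc : algebraMap F W.CoordinateRing c ∈ CoordinateRing.XYIdeal W x (C y)) : c = 0 := by
    by_contra hc0
    exact (XYIdeal_isMaximal h).ne_top
      (Ideal.eq_top_of_isUnit_mem _ hc ((isUnit_iff_ne_zero.2 hc0).map _))
  constructor
  · refine (sub_eq_zero.1 (eq_zero_of_mem _ ?_)).symm
    rw [← XClass_sub_XClass]
    exact sub_mem (XClass_mem_XYIdeal x _) (hI ▸ XClass_mem_XYIdeal x' _)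
  · refine (sub_eq_zero.1 (eq_zero_of_mem _ ?_)).symm
    rw [← YClass_sub_YClass]
    exact sub_mem (YClass_mem_XYIdeal x _) (hI ▸ YClass_mem_XYIdeal x' _)

theorem exists_mk_eq_evalEval [IsAlgClosed F] (M : Ideal W.CoordinateRing) [M.IsMaximal] :
    ∃ x y : F, ∀ g : F[X][X], Ideal.Quotient.mk M (CoordinateRing.mk W g) =
      algebraMap F (W.CoordinateRing ⧸ M) (g.evalEval x y) := by
  let _ : Field (W.CoordinateRing ⧸ M) := Ideal.Quotient.field M
  have : Algebra.FiniteType F W.CoordinateRing :=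
    Algebra.FiniteType.trans (S := F[X]) inferInstance inferInstance
  -- Zariski's lemma: the residue field is finite over `F`.
  have : Module.Finite F (W.CoordinateRing ⧸ M) := finite_of_finite_type_of_isJacobsonRing _ _
  have hsurj := (IsAlgClosed.algebraMap_bijective_of_isIntegral (k := F)
    (K := W.CoordinateRing ⧸ M)).2
  obtain ⟨x, hx⟩ := hsurj (Ideal.Quotient.mk M (CoordinateRing.mk W (C X)))
  obtain ⟨y, hy⟩ := hsurj (Ideal.Quotient.mk M (CoordinateRing.mk W X))
  have hhom : (Ideal.Quotient.mk M).comp (CoordinateRing.mk W) =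
      (algebraMap F (W.CoordinateRing ⧸ M)).comp (evalEvalRingHom x y) := by
    refine Polynomial.ringHom_ext' (Polynomial.ringHom_ext' (RingHom.ext fun c => ?_) ?_) ?_
    · simp only [RingHom.comp_apply, coe_evalRingHom, eval_C]
      rfl
    · simp [hx]
    · simp [hy]
  exact ⟨x, y, RingHom.congr_fun hhom⟩

theorem exists_eq_XYIdeal [IsAlgClosed F] (M : Ideal W.CoordinateRing) (hM : M.IsMaximal) :
    ∃ x y, W.Equation x y ∧ M = CoordinateRing.XYIdeal W x (C y) := by
  obtain ⟨x, y, hmk⟩ := exists_mk_eq_evalEval M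
  have hxy : W.Equation x y := by
    have hzero : CoordinateRing.mk W W.polynomial = 0 := AdjoinRoot.mk_self
    have heval := hmk W.polynomial
    rw [hzero, map_zero] at heval
    exact (map_eq_zero_iff _ (algebraMap F (W.CoordinateRing ⧸ M)).injective).1 heval.symm
  refine ⟨x, y, hxy, ((XYIdeal_isMaximal hxy).eq_of_le hM.ne_top ?_).symm⟩
  rw [CoordinateRing.XYIdeal, Ideal.span_le]
  rintro r (rfl | rfl)
  · rw [SetLike.mem_coe, ← Ideal.Quotient.eq_zero_iff_mem, CoordinateRing.XClass, hmk]
    simp [evalEval]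
  · rw [SetLike.mem_coe, ← Ideal.Quotient.eq_zero_iff_mem, CoordinateRing.YClass, hmk]
    simp

instance isDedekindDomain_coordinateRing [IsAlgClosed F] [W.IsElliptic] :
    IsDedekindDomain W.CoordinateRing := by
  refine isDedekindDomain_of_forall_isMaximal_isUnit fun M hM _ => ?_
  obtain ⟨x, y, h, rfl⟩ := exists_eq_XYIdeal M hM
  exact ⟨CoordinateRing.XYIdeal' (equation_iff_nonsingular.1 h), rfl⟩

/-- The invertible fractional ideal of a point of `W`. The origin does not lie on the affine curve
and is sent to the unit ideal. -/
def pointIdeal : W.Point → (FractionalIdeal W.CoordinateRing⁰ W.FunctionField)ˣ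
  | .zero => 1
  | .some _ _ h => CoordinateRing.XYIdeal' h

theorem toClass_eq_mk_pointIdeal [DecidableEq F] (P : W.Point) :
    Point.toClass P = Additive.ofMul (ClassGroup.mk W.FunctionField (pointIdeal P)) := by
  cases P with
  | zero => exact (congrArg Additive.ofMul (map_one (ClassGroup.mk W.FunctionField))).symm
  | some x y h => rfl

/-- The prime of the coordinate ring at an affine point of `W`. -/
def pointPrime {x y : F} (h : W.Nonsingular x y) : HeightOneSpectrum W.CoordinateRing where
  asIdeal := CoordinateRing.XYIdeal W x (C y)
  isPrime := (XYIdeal_isMaximal h.1).isPrime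
  ne_bot := XYIdeal_ne_bot x (C y)

theorem exists_eq_pointPrime [IsAlgClosed F] [W.IsElliptic]
    (v : HeightOneSpectrum W.CoordinateRing) :
    ∃ (x y : F) (h : W.Nonsingular x y), v = pointPrime h := by
  obtain ⟨x, y, h, hv⟩ := exists_eq_XYIdeal v.asIdeal v.isMaximal
  exact ⟨x, y, equation_iff_nonsingular.1 h, HeightOneSpectrum.ext hv⟩

theorem pointPrime_eq_iff {x y x' y' : F} (h : W.Nonsingular x y) (h' : W.Nonsingular x' y') :
    pointPrime h = pointPrime h' ↔ x = x' ∧ y = y' :=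
  ⟨fun he => eq_and_eq_of_XYIdeal_eq h.1 (congrArg HeightOneSpectrum.asIdeal he),
    by rintro ⟨rfl, rfl⟩; rfl⟩

section Dedekind

variable [IsDedekindDomain W.CoordinateRing]

theorem ord_YClass_eq_one {x y : F} (h : W.Nonsingular x y)
    (hX : 1 < ord (pointPrime h) (algebraMap _ W.FunctionField (CoordinateRing.XClass W x))) :
    ord (pointPrime h) (algebraMap _ W.FunctionField (CoordinateRing.YClass W (C y))) = 1 := by
  have hX2 : CoordinateRing.XClass W x ∈ (pointPrime h).asIdeal ^ 2 :=
    (le_ord_algebraMap_iff_mem_pow _ (CoordinateRing.XClass_ne_zero x) 2).1 hX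
  have hY1 := (le_ord_algebraMap_iff_mem_pow (K := W.FunctionField) (pointPrime h)
    (CoordinateRing.YClass_ne_zero (W' := W) (C y)) 1).2
      (by rw [pow_one]; exact YClass_mem_XYIdeal x (C y))
  refine le_antisymm (not_lt.1 fun hY => ?_) (mod_cast hY1)
  have hY2 : CoordinateRing.YClass W (C y) ∈ (pointPrime h).asIdeal ^ 2 :=
    (le_ord_algebraMap_iff_mem_pow _ (CoordinateRing.YClass_ne_zero (C y)) 2).1 hY
  have hle : (pointPrime h).asIdeal ≤ (pointPrime h).asIdeal ^ 2 :=
    Ideal.span_le.2 (by rintro r (rfl | rfl) <;> assumption)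
  rw [pow_two] at hle
  exact hle.not_gt
    (mul_lt_of_ne_bot_of_ne_top (pointPrime h).ne_bot (pointPrime h).isPrime.ne_top)

theorem count_pointIdeal [DecidableEq F] {x y : F} (h : W.Nonsingular x y) (P : W.Point) :
    count W.FunctionField (pointPrime h) (pointIdeal P : FractionalIdeal _ W.FunctionField) =
      if P = .some x y h then 1 else 0 := by
  classical
  cases P with
  | zero =>
    rw [if_neg (by simp)]
    exact count_one ..
  | some x' y' h' =>
    refine (count_maximal W.FunctionField (pointPrime h) (pointPrime h')).trans ?_
    simp only [pointPrime_eq_iff, Point.some.injEq]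

theorem count_prod_pointIdeal_zpow {x y : F} (h : W.Nonsingular x y) (G : W.Point →₀ ℤ) :
    count W.FunctionField (pointPrime h)
      ((G.prod fun P n => pointIdeal P ^ n : (FractionalIdeal W.CoordinateRing⁰ W.FunctionField)ˣ) :
        FractionalIdeal W.CoordinateRing⁰ W.FunctionField) = G (.some x y h) := by
  classical
  rw [Finsupp.prod, Units.coe_prod, count_prod _ _ _ _ fun _ _ => Units.ne_zero _]
  simp_rw [Units.val_zpow_eq_zpow_val, count_zpow, count_pointIdeal]
  simp only [mul_ite, mul_one, mul_zero, Finset.sum_ite_eq', Finsupp.mem_support_iff]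
  split_ifs with h0
  · rfl
  · exact (not_not.1 h0).symm

theorem ord_XClass [DecidableEq F] {x y x' y' : F} (h : W.Nonsingular x y)
    (h' : W.Nonsingular x' y') :
    ord (pointPrime h) (algebraMap _ W.FunctionField (CoordinateRing.XClass W x')) =
      (if Point.some x' y' h' = .some x y h then 1 else 0) +
        if -Point.some x' y' h' = .some x y h then 1 else 0 := by
  have hI : spanSingleton W.CoordinateRing⁰
      (algebraMap _ W.FunctionField (CoordinateRing.XClass W x')) =
      (pointIdeal (-Point.some x' y' h') : FractionalIdeal _ W.FunctionField) *
        (pointIdeal (Point.some x' y' h') : FractionalIdeal _ W.FunctionField) := by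
    rw [← coeIdeal_span_singleton]
    exact (congrArg _ (CoordinateRing.XYIdeal_neg_mul h').symm).trans (coeIdeal_mul ..)
  rw [ord, hI, count_mul _ _ (Units.ne_zero _) (Units.ne_zero _), count_pointIdeal,
    count_pointIdeal, add_comm]

theorem ord_line [DecidableEq F] {x y x₁ y₁ x₂ y₂ : F} (h : W.Nonsingular x y)
    (h₁ : W.Nonsingular x₁ y₁) (h₂ : W.Nonsingular x₂ y₂) (hxy : ¬(x₁ = x₂ ∧ y₁ = W.negY x₂ y₂)) :
    ord (pointPrime h) (algebraMap _ W.FunctionField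
        (CoordinateRing.YClass W (linePolynomial x₁ y₁ (W.slope x₁ x₂ y₁ y₂))) /
      algebraMap _ W.FunctionField
        (CoordinateRing.XClass W (W.addX x₁ x₂ (W.slope x₁ x₂ y₁ y₂)))) =
      (if Point.some x₁ y₁ h₁ = .some x y h then 1 else 0) +
        (if Point.some x₂ y₂ h₂ = .some x y h then 1 else 0) -
        if Point.some x₁ y₁ h₁ + Point.some x₂ y₂ h₂ = .some x y h then 1 else 0 := by
  set a := algebraMap _ W.FunctionField
    (CoordinateRing.YClass W (linePolynomial x₁ y₁ (W.slope x₁ x₂ y₁ y₂))) with ha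
  set b := algebraMap _ W.FunctionField
    (CoordinateRing.XClass W (W.addX x₁ x₂ (W.slope x₁ x₂ y₁ y₂))) with hb
  have ha0 : a ≠ 0 := by simpa [ha] using CoordinateRing.YClass_ne_zero _
  have hb0 : b ≠ 0 := by simpa [hb] using CoordinateRing.XClass_ne_zero _
  have hI : spanSingleton W.CoordinateRing⁰ b *
      ((pointIdeal (Point.some x₁ y₁ h₁) : FractionalIdeal _ W.FunctionField) *
        (pointIdeal (Point.some x₂ y₂ h₂) : FractionalIdeal _ W.FunctionField)) =
      spanSingleton W.CoordinateRing⁰ a *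
        (pointIdeal (Point.some x₁ y₁ h₁ + Point.some x₂ y₂ h₂) :
          FractionalIdeal _ W.FunctionField) := by
    have hXY := congrArg (coeIdeal (S := W.CoordinateRing⁰) (P := W.FunctionField))
      (CoordinateRing.XYIdeal_mul_XYIdeal h₁.1 h₂.1 hxy)
    simp only [coeIdeal_mul] at hXY
    rw [Point.add_some hxy, hb, ha, ← coeIdeal_span_singleton, ← coeIdeal_span_singleton]
    exact hXY
  have hcount := congrArg (count W.FunctionField (pointPrime h)) hI
  rw [count_mul _ _ (spanSingleton_ne_zero_iff.2 hb0) (Units.ne_zero (_ * _)),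
    count_mul _ _ (Units.ne_zero _) (Units.ne_zero _),
    count_mul _ _ (spanSingleton_ne_zero_iff.2 ha0) (Units.ne_zero _), count_pointIdeal,
    count_pointIdeal, count_pointIdeal] at hcount
  rw [ord_div _ ha0 hb0, ord, ord]
  linarith

end Dedekind

theorem sum_smul_eq_zero_of_ord_eq [IsAlgClosed F] [W.IsElliptic] [DecidableEq F]
    (G : W.Point →₀ ℤ) {φ : W.FunctionField} (hφ : φ ≠ 0)
    (hG : ∀ (x y : F) (h : W.Nonsingular x y), ord (pointPrime h) φ = G (.some x y h)) :
    G.sum (fun P n => n • P) = 0 := by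
  have hprincipal : ((G.prod fun P n => pointIdeal P ^ n :
      (FractionalIdeal W.CoordinateRing⁰ W.FunctionField)ˣ) :
      FractionalIdeal W.CoordinateRing⁰ W.FunctionField) = spanSingleton _ φ := by
    refine eq_of_forall_count_eq (Units.ne_zero _) (spanSingleton_ne_zero_iff.2 hφ) fun v => ?_
    obtain ⟨x, y, h, rfl⟩ := exists_eq_pointPrime v
    rw [count_prod_pointIdeal_zpow, ← hG x y h, ord]
  have hclass : ClassGroup.mk W.FunctionField (G.prod fun P n => pointIdeal P ^ n) = 1 := by
    rw [ClassGroup.mk_eq_one_iff, hprincipal, coe_spanSingleton]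
    exact ⟨φ, rfl⟩
  refine Point.toClass_injective ?_
  rw [map_zero, ← ofMul_one, ← hclass, Finsupp.sum, map_sum, Finsupp.prod, map_prod, ofMul_prod]
  refine Finset.sum_congr rfl fun P _ => ?_
  rw [map_zsmul, map_zpow, ofMul_zpow, toClass_eq_mk_pointIdeal]

end Weierstrass

/-! ### Homomorphisms from the function field of `C` -/

theorem injective_of_injective_comp_algebraMap {R S T : Type*} [CommRing R] [Nontrivial R]
    [CommRing S] [IsDomain S] [Algebra R S] [Algebra.IsIntegral R S] [Semiring T]
    (f : S →+* T) (hf : Function.Injective (f.comp (algebraMap R S))) : Function.Injective f := by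
  rw [RingHom.injective_iff_ker_eq_bot] at hf ⊢
  exact Ideal.eq_bot_of_comap_eq_bot (R := R) ((RingHom.comap_ker _ _).trans hf)

theorem ne_zero_of_pow_eq_one {M : Type*} [MonoidWithZero M] [Nontrivial M] {a : M} {n : ℕ}
    (h : a ^ n = 1) (hn : n ≠ 0) : a ≠ 0 :=
  (IsUnit.of_pow_eq_one h hn).ne_zero

theorem div_pow_three_sq_eq {K : Type*} [Field K] {a b : K} (h : b ^ 2 = a ^ 6 + 1) (ha : a ≠ 0) :
    (b / a ^ 3) ^ 2 = a⁻¹ ^ 6 + 1 := by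
  rw [div_pow, h]
  field_simp
  ring

section coordHom

variable {p : ℕ} [Fact p.Prime] {L : Type*} [CommRing L] [Algebra (Fbar p) L]
  (σ : Fbar p →+* Fbar p)

/-- The homomorphism from the coordinate ring of `C` to an `𝔽̄_p`-algebra that is given by `σ` on
constants and maps `x` and `y` to `u` and `v`. -/
def coordHom (u v : L) (h : v ^ 2 = u ^ 6 + 1) : CoordRing p →+* L :=
  AdjoinRoot.lift (eval₂RingHom ((algebraMap (Fbar p) L).comp σ) u) v (by
    rw [eval₂_sub, eval₂_pow, eval₂_X, eval₂_C, h]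
    simp)

variable {u v : L} (h : v ^ 2 = u ^ 6 + 1)

theorem coordHom_of (g : (Fbar p)[X]) :
    coordHom σ u v h (AdjoinRoot.of _ g) = aeval u (g.map σ) := by
  rw [coordHom, AdjoinRoot.lift_of, aeval_def, eval₂_map]
  rfl

@[simp]
theorem coordHom_algebraMap (c : Fbar p) :
    coordHom σ u v h (algebraMap (Fbar p) _ c) = algebraMap _ L (σ c) := by
  change coordHom σ u v h (AdjoinRoot.of _ (C c)) = _
  rw [coordHom_of, map_C, aeval_C]

@[simp]
theorem coordHom_x : coordHom σ u v h (AdjoinRoot.of _ X) = u := by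
  rw [coordHom_of, map_X, aeval_X]

@[simp]
theorem coordHom_y : coordHom σ u v h (AdjoinRoot.root _) = v := by
  rw [coordHom, AdjoinRoot.lift_root]

end coordHom

section

variable {p : ℕ} [Fact p.Prime]

theorem aeval_xFun (g : (Fbar p)[X]) :
    aeval (xFun p) g = algebraMap (CoordRing p) (FunctionField p) (AdjoinRoot.of _ g) := by
  change aeval (algebraMap (Fbar p)[X] (FunctionField p) X) g = algebraMap (Fbar p)[X] _ g
  rw [aeval_algebraMap_apply, aeval_X_left_apply]

variable [Fact (p ≠ 2)] [Fact (p % 3 = 2)]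

theorem xFun_ne_zero : xFun p ≠ 0 := by simpa using xFun_ne_algebraMap (p := p) 0

theorem transcendental_xFun : Transcendental (Fbar p) (xFun p) :=
  transcendental_iff.2 fun g hg => by_contra fun hg0 => of_ne_zero hg0 (aeval_xFun g ▸ hg)

section fieldHom

variable {L : Type*} [Field L] [Algebra (Fbar p) L] (σ : Fbar p →+* Fbar p) {u v : L}
  (h : v ^ 2 = u ^ 6 + 1) (hu : Transcendental (Fbar p) u)

include hu in
theorem coordHom_injective : Function.Injective (coordHom σ u v h) := by
  have : Module.Finite (Fbar p)[X] (CoordRing p) :=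
    (monic_X_pow_sub_C (X ^ 6 + 1 : (Fbar p)[X]) two_ne_zero).finite_adjoinRoot
  refine injective_of_injective_comp_algebraMap (R := (Fbar p)[X]) _
    ((injective_iff_map_eq_zero _).2 fun g hg => ?_)
  have hg0 := transcendental_iff.1 hu _ ((coordHom_of σ h g).symm.trans hg)
  rwa [Polynomial.map_eq_zero] at hg0

/-- The homomorphism from the function field of `C` that is given by `σ` on constants and maps `x`
and `y` to `u` and `v`. -/
def fieldHom {L : Type*} [Field L] [Algebra (Fbar p) L] (σ : Fbar p →+* Fbar p) (u v : L)
    (h : v ^ 2 = u ^ 6 + 1) (hu : Transcendental (Fbar p) u) : FunctionField p →+* L :=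
  IsFractionRing.lift (coordHom_injective σ h hu)

@[simp]
theorem fieldHom_algebraMap (c : Fbar p) :
    fieldHom σ u v h hu (algebraMap (Fbar p) _ c) = algebraMap _ L (σ c) := by
  rw [IsScalarTower.algebraMap_apply (Fbar p) (CoordRing p) (FunctionField p), fieldHom,
    IsFractionRing.lift_algebraMap, coordHom_algebraMap]

@[simp]
theorem fieldHom_x : fieldHom σ u v h hu (xFun p) = u := by
  rw [xFun, fieldHom, IsFractionRing.lift_algebraMap, coordHom_x]

@[simp]
theorem fieldHom_y : fieldHom σ u v h hu (yFun p) = v := by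
  rw [yFun, fieldHom, IsFractionRing.lift_algebraMap, coordHom_y]

end fieldHom

variable (p) in
/-- The pull-back of functions by `(x, y) ↦ (1 / x, y / x³)`. -/
def chiField : FunctionField p →+* FunctionField p :=
  fieldHom (RingHom.id _) (xFun p)⁻¹ (yFun p / xFun p ^ 3)
    (div_pow_three_sq_eq yFun_sq xFun_ne_zero)
    fun halg => transcendental_xFun (p := p) (by simpa using halg.inv)

@[simp]
theorem chiField_algebraMap (c : Fbar p) :
    chiField p (algebraMap (Fbar p) _ c) = algebraMap (Fbar p) _ c :=
  fieldHom_algebraMap ..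

@[simp]
theorem chiField_x : chiField p (xFun p) = (xFun p)⁻¹ := fieldHom_x ..

@[simp]
theorem chiField_y : chiField p (yFun p) = yFun p / xFun p ^ 3 := fieldHom_y ..

/-- The pull-back of functions by `(x, y) ↦ (ζ⁻¹ x, y)`, the inverse of `rhoC ζ`: a function of
order `n` at `P` is carried to one of order `n` at `rhoC ζ P`. -/
def rhoField (ζ : Fbar p) (hζ : ζ ^ 6 = 1) : FunctionField p →+* FunctionField p :=
  fieldHom (RingHom.id _) (algebraMap (Fbar p) _ ζ⁻¹ * xFun p) (yFun p)
    (by rw [mul_pow, ← map_pow, inv_pow, hζ, inv_one, map_one, one_mul, yFun_sq])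
    fun halg => transcendental_xFun (p := p) (by
      have hζ0 := ne_zero_of_pow_eq_one hζ (by norm_num)
      have halg_x := (isAlgebraic_algebraMap (R := Fbar p) (A := FunctionField p) ζ).mul halg
      rwa [← mul_assoc, ← map_mul, mul_inv_cancel₀ hζ0, map_one, one_mul] at halg_x)

@[simp]
theorem rhoField_algebraMap {ζ : Fbar p} (hζ : ζ ^ 6 = 1) (c : Fbar p) :
    rhoField ζ hζ (algebraMap (Fbar p) _ c) = algebraMap (Fbar p) _ c :=
  fieldHom_algebraMap ..

@[simp]
theorem rhoField_x {ζ : Fbar p} (hζ : ζ ^ 6 = 1) :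
    rhoField ζ hζ (xFun p) = algebraMap (Fbar p) _ ζ⁻¹ * xFun p :=
  fieldHom_x ..

@[simp]
theorem rhoField_y {ζ : Fbar p} (hζ : ζ ^ 6 = 1) : rhoField ζ hζ (yFun p) = yFun p := fieldHom_y ..

variable (p) in
/-- The action of the Frobenius automorphism of `𝔽̄_p` on the coefficients of functions. -/
def frobField : FunctionField p →+* FunctionField p :=
  fieldHom (frobenius (Fbar p) p) (xFun p) (yFun p) yFun_sq transcendental_xFun

@[simp]
theorem frobField_algebraMap (c : Fbar p) :
    frobField p (algebraMap (Fbar p) _ c) = algebraMap (Fbar p) _ (c ^ p) :=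
  fieldHom_algebraMap ..

@[simp]
theorem frobField_x : frobField p (xFun p) = xFun p := fieldHom_x ..

@[simp]
theorem frobField_y : frobField p (yFun p) = yFun p := fieldHom_y ..

end

/-! ### Values and orders of functions on `C` -/

section

variable {p : ℕ} [Fact p.Prime]

theorem eval_affine_eq_zero_of_aeval_eq_zero {a b : Fbar p} (h : b ^ 2 = a ^ 6 + 1)
    {g : MvPolynomial (Fin 2) (Fbar p)} (hg : MvPolynomial.aeval ![xFun p, yFun p] g = 0) :
    MvPolynomial.eval ![a, b] g = 0 := by
  let coords : Fin 2 → CoordRing p := ![AdjoinRoot.of _ X, AdjoinRoot.root _]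
  have hcoords : MvPolynomial.aeval coords g = 0 := by
    refine (FaithfulSMul.algebraMap_eq_zero_iff (CoordRing p) (FunctionField p)).1 ?_
    rw [← hg, ← MvPolynomial.aeval_algebraMap_apply]
    congr 2
    funext i
    fin_cases i <;> rfl
  have heval := congrArg (coordHom (RingHom.id (Fbar p)) a b h) hcoords
  rw [map_zero, MvPolynomial.aeval_def, MvPolynomial.hom_eval₂] at heval
  rw [← heval, MvPolynomial.eval, MvPolynomial.coe_eval₂Hom]
  congr 1
  · ext c
    simp
  · funext i
    fin_cases i <;> simp [coords]

variable [Fact (p ≠ 2)] [Fact (p % 3 = 2)]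

/-- The function `u` is regular at `P`, with value `c`: it is a quotient of two polynomials in the
chart coordinates at `P`, whose values at `P` have the quotient `c` and whose denominator does not
vanish at `P`. -/
def HasValue (P : CPoint p) (u : FunctionField p) (c : Fbar p) : Prop :=
  ∃ g h : MvPolynomial (Fin 2) (Fbar p), MvPolynomial.eval (chartValue p P) h ≠ 0 ∧
    u = MvPolynomial.aeval (chart p P) g / MvPolynomial.aeval (chart p P) h ∧
    c = MvPolynomial.eval (chartValue p P) g / MvPolynomial.eval (chartValue p P) h

theorem eval_eq_zero_of_aeval_eq_zero (P : CPoint p) {g : MvPolynomial (Fin 2) (Fbar p)}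
    (hg : MvPolynomial.aeval (chart p P) g = 0) : MvPolynomial.eval (chartValue p P) g = 0 := by
  cases P with
  | affine a b h => exact eval_affine_eq_zero_of_aeval_eq_zero h hg
  | infty s h =>
    -- `χ` exchanges the chart at infinity with the affine one.
    refine eval_affine_eq_zero_of_aeval_eq_zero (a := 0) (b := s) (by rw [h]; norm_num)
      ((chiField p).injective ?_)
    rw [map_zero, ← hg, MvPolynomial.aeval_def, MvPolynomial.aeval_def, MvPolynomial.hom_eval₂]
    congr 1
    · ext c
      simp
    · funext i
      fin_cases i <;> simp [chart]

theorem aeval_ne_zero {P : CPoint p} {g : MvPolynomial (Fin 2) (Fbar p)}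
    (hg : MvPolynomial.eval (chartValue p P) g ≠ 0) : MvPolynomial.aeval (chart p P) g ≠ 0 :=
  fun h => hg (eval_eq_zero_of_aeval_eq_zero P h)

namespace HasValue

variable {P : CPoint p} {u v : FunctionField p} {c d : Fbar p}

protected theorem aeval (P : CPoint p) (g : MvPolynomial (Fin 2) (Fbar p)) :
    HasValue P (MvPolynomial.aeval (chart p P) g) (MvPolynomial.eval (chartValue p P) g) :=
  ⟨g, 1, by simp, by simp, by simp⟩

protected theorem chart (P : CPoint p) (i : Fin 2) :
    HasValue P (chart p P i) (chartValue p P i) := by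
  simpa using HasValue.aeval P (MvPolynomial.X i)

theorem const (P : CPoint p) (c : Fbar p) : HasValue P (algebraMap (Fbar p) _ c) c := by
  simpa using HasValue.aeval P (MvPolynomial.C c)

theorem one (P : CPoint p) : HasValue P 1 1 := by simpa using const P 1

theorem add (hu : HasValue P u c) (hv : HasValue P v d) : HasValue P (u + v) (c + d) := by
  obtain ⟨g, h, hh, rfl, rfl⟩ := hu
  obtain ⟨g', h', hh', rfl, rfl⟩ := hv
  exact ⟨g * h' + h * g', h * h', by simpa using ⟨hh, hh'⟩,
    by simp [div_add_div _ _ (aeval_ne_zero hh) (aeval_ne_zero hh')],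
    by simp [div_add_div _ _ hh hh']⟩

theorem mul (hu : HasValue P u c) (hv : HasValue P v d) : HasValue P (u * v) (c * d) := by
  obtain ⟨g, h, hh, rfl, rfl⟩ := hu
  obtain ⟨g', h', hh', rfl, rfl⟩ := hv
  exact ⟨g * g', h * h', by simpa using ⟨hh, hh'⟩,
    by simp [div_mul_div_comm], by simp [div_mul_div_comm]⟩

theorem neg (hu : HasValue P u c) : HasValue P (-u) (-c) := by
  simpa using (const P (-1)).mul hu

theorem sub (hu : HasValue P u c) (hv : HasValue P v d) : HasValue P (u - v) (c - d) := by
  simpa [sub_eq_add_neg] using hu.add hv.neg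

theorem pow (hu : HasValue P u c) (n : ℕ) : HasValue P (u ^ n) (c ^ n) := by
  induction n with
  | zero => simpa using one P
  | succ n ih => simpa [pow_succ] using ih.mul hu

theorem inv (hu : HasValue P u c) (hc : c ≠ 0) : HasValue P u⁻¹ c⁻¹ := by
  obtain ⟨g, h, -, rfl, rfl⟩ := hu
  exact ⟨h, g, (div_ne_zero_iff.1 hc).1, by simp, by simp⟩

theorem div (hu : HasValue P u c) (hv : HasValue P v d) (hd : d ≠ 0) :
    HasValue P (u / v) (c / d) := by
  simpa [div_eq_mul_inv] using hu.mul (hv.inv hd)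

theorem isUnitAt (hu : HasValue P u c) (hc : c ≠ 0) : IsUnitAt P u := by
  obtain ⟨g, h, hh, rfl, rfl⟩ := hu
  exact ⟨g, h, (div_ne_zero_iff.1 hc).1, hh, rfl⟩

theorem unique (hu : HasValue P u c) (hv : HasValue P u d) : c = d := by
  have hzero := hu.sub hv
  rw [sub_self] at hzero
  obtain ⟨g, h, hh, hu0, hcd⟩ := hzero
  rw [eq_comm, div_eq_zero_iff, or_iff_left (aeval_ne_zero hh)] at hu0
  rw [eval_eq_zero_of_aeval_eq_zero P hu0, zero_div] at hcd
  exact sub_eq_zero.1 hcd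

theorem map_aeval {P Q : CPoint p} {f : FunctionField p →+* FunctionField p}
    {σ : Fbar p →+* Fbar p} (hσ : ∀ c, f (algebraMap (Fbar p) _ c) = algebraMap _ _ (σ c))
    (hf : ∀ i, HasValue Q (f (chart p P i)) (σ (chartValue p P i)))
    (g : MvPolynomial (Fin 2) (Fbar p)) :
    HasValue Q (f (MvPolynomial.aeval (chart p P) g))
      (σ (MvPolynomial.eval (chartValue p P) g)) := by
  induction g using MvPolynomial.induction_on with
  | C c => simpa [hσ] using const Q (σ c)
  | add g h hg hh => simpa using hg.add hh
  | mul_X g i hg => simpa using hg.mul (hf i)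

end HasValue

namespace IsUnitAt

variable {P : CPoint p} {u : FunctionField p}

theorem exists_hasValue (hu : IsUnitAt P u) : ∃ c ≠ 0, HasValue P u c := by
  obtain ⟨g, h, hg, hh, rfl⟩ := hu
  exact ⟨_, div_ne_zero hg hh, g, h, hh, rfl, rfl⟩

theorem ne_zero (hu : IsUnitAt P u) : u ≠ 0 := by
  obtain ⟨g, h, hg, hh, rfl⟩ := hu
  exact div_ne_zero (aeval_ne_zero hg) (aeval_ne_zero hh)

theorem pow (hu : IsUnitAt P u) (n : ℕ) : IsUnitAt P (u ^ n) := by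
  induction n with
  | zero => simpa using IsUnitAt.one P
  | succ n ih => simpa [pow_succ] using ih.mul hu

theorem zpow (hu : IsUnitAt P u) (n : ℤ) : IsUnitAt P (u ^ n) := by
  cases n with
  | ofNat n => simpa using hu.pow n
  | negSucc n => simpa using (hu.pow (n + 1)).inv

theorem map {P Q : CPoint p} {f : FunctionField p →+* FunctionField p}
    {σ : Fbar p →+* Fbar p} (hσ : ∀ c, f (algebraMap (Fbar p) _ c) = algebraMap _ _ (σ c))
    (hf : ∀ i, HasValue Q (f (chart p P i)) (σ (chartValue p P i))) {u : FunctionField p}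
    (hu : IsUnitAt P u) : IsUnitAt Q (f u) := by
  obtain ⟨g, h, hg, hh, rfl⟩ := hu
  rw [map_div₀]
  refine ((HasValue.map_aeval hσ hf g).div (HasValue.map_aeval hσ hf h) ?_).isUnitAt ?_
  · simpa using hh
  · simpa using ⟨hg, hh⟩

end IsUnitAt

theorem hasValue_uniformizer (P : CPoint p) : HasValue P (uniformizer P) 0 := by
  cases P with
  | affine a b h =>
    rw [uniformizer]
    split_ifs with hb
    · simpa [chart, chartValue, hb] using HasValue.chart (.affine a b h) 1
    · simpa [chart, chartValue] using
        (HasValue.chart (.affine a b h) 0).sub (HasValue.const (.affine a b h) a)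
  | infty s h => exact HasValue.chart (.infty s h) 0

namespace HasOrd

variable {P : CPoint p} {φ ψ : FunctionField p} {m n : ℤ}

theorem of_isUnitAt (h : IsUnitAt P φ) : HasOrd P φ 0 := ⟨φ, h, by simp⟩

theorem of_hasValue {c : Fbar p} (h : HasValue P φ c) (hc : c ≠ 0) : HasOrd P φ 0 :=
  of_isUnitAt (h.isUnitAt hc)

protected theorem uniformizer (P : CPoint p) : HasOrd P (uniformizer P) 1 :=
  ⟨1, IsUnitAt.one P, by simp⟩

theorem ne_zero (hφ : HasOrd P φ n) : φ ≠ 0 := by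
  obtain ⟨u, hu, rfl⟩ := hφ
  exact mul_ne_zero (zpow_ne_zero _ (uniformizer_ne_zero P)) hu.ne_zero

theorem mul (hφ : HasOrd P φ m) (hψ : HasOrd P ψ n) : HasOrd P (φ * ψ) (m + n) := by
  obtain ⟨u, hu, rfl⟩ := hφ
  obtain ⟨v, hv, rfl⟩ := hψ
  refine ⟨u * v, hu.mul hv, ?_⟩
  rw [zpow_add₀ (uniformizer_ne_zero P)]
  ring

theorem zpow (hφ : HasOrd P φ m) (n : ℤ) : HasOrd P (φ ^ n) (n * m) := by
  obtain ⟨u, hu, rfl⟩ := hφ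
  exact ⟨u ^ n, hu.zpow n, by rw [mul_zpow, ← zpow_mul, mul_comm m]⟩

theorem inv (hφ : HasOrd P φ m) : HasOrd P φ⁻¹ (-m) := by simpa using hφ.zpow (-1)

theorem div (hφ : HasOrd P φ m) (hψ : HasOrd P ψ n) : HasOrd P (φ / ψ) (m - n) := by
  simpa [div_eq_mul_inv, sub_eq_add_neg] using hφ.mul hψ.inv

theorem hasValue_zero (hφ : HasOrd P φ n) (hn : 0 < n) : HasValue P φ 0 := by
  obtain ⟨u, hu, rfl⟩ := hφ
  obtain ⟨c, -, hc⟩ := hu.exists_hasValue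
  lift n to ℕ using hn.le
  simpa [zero_pow (Nat.cast_pos.1 hn).ne'] using ((hasValue_uniformizer P).pow n).mul hc

theorem nonpos_of_one (h : HasOrd P 1 n) : n ≤ 0 :=
  not_lt.1 fun hn => zero_ne_one ((h.hasValue_zero hn).unique (HasValue.one P))

theorem unique (hφ : HasOrd P φ m) (hφ' : HasOrd P φ n) : m = n := by
  have hmn := hφ.div hφ'
  have hnm := hφ'.div hφ
  rw [div_self hφ.ne_zero] at hmn hnm
  exact le_antisymm (sub_nonpos.1 hmn.nonpos_of_one) (sub_nonpos.1 hnm.nonpos_of_one)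

theorem map {P Q : CPoint p} {f : FunctionField p →+* FunctionField p}
    {σ : Fbar p →+* Fbar p} (hσ : ∀ c, f (algebraMap (Fbar p) _ c) = algebraMap _ _ (σ c))
    (hf : ∀ i, HasValue Q (f (chart p P i)) (σ (chartValue p P i)))
    (ht : HasOrd Q (f (uniformizer P)) 1) (hφ : HasOrd P φ n) : HasOrd Q (f φ) n := by
  obtain ⟨u, hu, rfl⟩ := hφ
  rw [map_mul, map_zpow₀]
  simpa using (ht.zpow n).mul (of_isUnitAt (hu.map hσ hf))

end HasOrd

section

variable {a b : Fbar p} (h : b ^ 2 = a ^ 6 + 1)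

theorem hasValue_x : HasValue (.affine a b h) (xFun p) a := HasValue.chart (.affine a b h) 0

theorem hasValue_y : HasValue (.affine a b h) (yFun p) b := HasValue.chart (.affine a b h) 1

theorem hasOrd_y (hb : b = 0) : HasOrd (.affine a b h) (yFun p) 1 := by
  simpa [uniformizer, hb] using HasOrd.uniformizer (.affine a b h)

theorem hasOrd_x_sub (hb : b ≠ 0) :
    HasOrd (.affine a b h) (xFun p - algebraMap (Fbar p) _ a) 1 := by
  simpa [uniformizer, hb] using HasOrd.uniformizer (.affine a b h)

variable {s : Fbar p} (hs : s ^ 2 = 1)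

theorem hasValue_infty_inv_x : HasValue (.infty s hs) (xFun p)⁻¹ 0 :=
  HasValue.chart (.infty s hs) 0

theorem hasValue_infty_y_div : HasValue (.infty s hs) (yFun p / xFun p ^ 3) s :=
  HasValue.chart (.infty s hs) 1

theorem hasOrd_infty_x : HasOrd (.infty s hs) (xFun p) (-1) := by
  simpa [uniformizer] using (HasOrd.uniformizer (.infty s hs)).inv

end

end

/-! ### Automorphisms of `C` and principal divisors -/

section

variable {p : ℕ} [Fact p.Prime]

theorem chiC_involutive : Function.Involutive (chiC p)
  | .affine a b h => by
    by_cases ha : a = 0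
    · simp [chiC, ha]
    · simp [chiC, ha]
  | .infty s h => by simp [chiC]

theorem rhoC_rhoC_of_mul_eq_one {ζ η : Fbar p} (hζ : ζ ^ 6 = 1) (hη : η ^ 6 = 1)
    (hmul : ζ * η = 1) (P : CPoint p) : rhoC ζ hζ (rhoC η hη P) = P := by
  cases P with
  | affine a b h => simp [rhoC, ← mul_assoc, hmul]
  | infty s h => simp [rhoC, div_div, ← mul_pow, mul_comm η, hmul]

theorem rhoC_bijective {ζ : Fbar p} (hζ : ζ ^ 6 = 1) : Function.Bijective (rhoC ζ hζ) := by
  have hζ0 := ne_zero_of_pow_eq_one hζ (by norm_num)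
  have hinv : ζ⁻¹ ^ 6 = 1 := by rw [inv_pow, hζ, inv_one]
  exact Function.bijective_iff_has_inverse.2 ⟨rhoC ζ⁻¹ hinv,
    rhoC_rhoC_of_mul_eq_one hinv hζ (inv_mul_cancel₀ hζ0),
    rhoC_rhoC_of_mul_eq_one hζ hinv (mul_inv_cancel₀ hζ0)⟩

theorem frobC_injective : Function.Injective (frobC p) := by
  have hinj : Function.Injective fun c : Fbar p => c ^ p := frobenius_inj (Fbar p) p
  rintro (⟨a, b, h⟩ | ⟨s, h⟩) (⟨a', b', h'⟩ | ⟨s', h'⟩) hPQ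
  · simp only [frobC, CPoint.affine.injEq] at hPQ ⊢
    exact ⟨hinj hPQ.1, hinj hPQ.2⟩
  · nomatch hPQ
  · nomatch hPQ
  · simp only [frobC, CPoint.infty.injEq] at hPQ ⊢
    exact hinj hPQ

theorem frobC_surjective : Function.Surjective (frobC p) := by
  have hinj : Function.Injective fun c : Fbar p => c ^ p := frobenius_inj (Fbar p) p
  have hroot (c : Fbar p) : ∃ d, d ^ p = c :=
    IsAlgClosed.exists_pow_nat_eq c (Fact.out : p.Prime).pos
  rintro (⟨a, b, h⟩ | ⟨s, h⟩)
  · obtain ⟨a, rfl⟩ := hroot a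
    obtain ⟨b, rfl⟩ := hroot b
    refine ⟨.affine a b (hinj ?_), rfl⟩
    simpa only [add_pow_char, one_pow, pow_right_comm _ p] using h
  · obtain ⟨s, rfl⟩ := hroot s
    refine ⟨.infty s (hinj ?_), rfl⟩
    simpa only [one_pow, pow_right_comm _ p] using h

variable [Fact (p ≠ 2)] [Fact (p % 3 = 2)]

theorem hasValue_chiField_chart (P : CPoint p) (i : Fin 2) :
    HasValue (chiC p P) (chiField p (chart p P i)) (chartValue p P i) := by
  have hx0 := xFun_ne_zero (p := p)
  cases P with
  | affine a b h =>
    rw [chiC]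
    split_ifs with ha
    · subst ha
      fin_cases i
      · simpa [chart, chartValue] using hasValue_infty_inv_x (p := p) _
      · simpa [chart, chartValue] using hasValue_infty_y_div (p := p) _
    · have hQ : (b / a ^ 3) ^ 2 = (1 / a) ^ 6 + 1 := by simpa using div_pow_three_sq_eq h ha
      fin_cases i
      · simpa [chart, chartValue] using (hasValue_x hQ).inv (by simpa using ha)
      · simpa [chart, chartValue, ha] using
          (hasValue_y hQ).div ((hasValue_x hQ).pow 3) (by simpa using ha)
  | infty s h =>
    have hQ : s ^ 2 = 0 ^ 6 + 1 := by simpa using h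
    fin_cases i
    · simpa [chiC, chart, chartValue] using hasValue_x hQ
    · simpa [chiC, chart, chartValue, hx0] using hasValue_y hQ

theorem hasOrd_chiField_uniformizer (P : CPoint p) :
    HasOrd (chiC p P) (chiField p (uniformizer P)) 1 := by
  cases P with
  | affine a b h =>
    rw [chiC]
    split_ifs with ha
    · have hb : b ≠ 0 := ne_zero_of_pow_eq_one (by simpa [ha] using h) two_ne_zero
      subst ha
      simpa [uniformizer, hb] using (hasOrd_infty_x (p := p) _).inv
    · have hQ : (b / a ^ 3) ^ 2 = (1 / a) ^ 6 + 1 := by simpa using div_pow_three_sq_eq h ha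
      have hx := hasValue_x hQ
      by_cases hb : b = 0
      · simpa [uniformizer, hb] using
          (hasOrd_y hQ (by simp [hb])).div (.of_hasValue (hx.pow 3) (by simpa using ha))
      · have hfactor : chiField p (uniformizer (.affine a b h)) =
            (xFun p - algebraMap (Fbar p) _ (1 / a)) * (algebraMap (Fbar p) _ (-a) / xFun p) := by
          have hx0 := xFun_ne_zero (p := p)
          have ha0 : algebraMap (Fbar p) (FunctionField p) a ≠ 0 := by simpa using ha
          simp only [uniformizer, hb, if_false, map_sub, chiField_x, chiField_algebraMap,
            map_div₀, map_one, map_neg]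
          field_simp
          ring
        rw [hfactor]
        exact (hasOrd_x_sub hQ (by simp [hb, ha])).mul
          (.of_hasValue ((HasValue.const _ (-a)).div hx (by simpa using ha)) (by simpa using ha))
  | infty s h =>
    have hQ : s ^ 2 = 0 ^ 6 + 1 := by simpa using h
    simpa [uniformizer, chiC] using hasOrd_x_sub hQ (ne_zero_of_pow_eq_one h two_ne_zero)

section rho

variable {ζ : Fbar p} (hζ : ζ ^ 6 = 1)

theorem hasValue_rhoField_chart (P : CPoint p) (i : Fin 2) :
    HasValue (rhoC ζ hζ P) (rhoField ζ hζ (chart p P i)) (chartValue p P i) := by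
  have hζ0 := ne_zero_of_pow_eq_one hζ (by norm_num)
  cases P with
  | affine a b h =>
    have hQ : b ^ 2 = (ζ * a) ^ 6 + 1 := by rw [mul_pow, hζ, one_mul, h]
    fin_cases i
    · simpa [rhoC, chart, chartValue, hζ0] using (HasValue.const _ ζ⁻¹).mul (hasValue_x hQ)
    · simpa [rhoC, chart, chartValue] using hasValue_y hQ
  | infty s h =>
    have hQ : (s / ζ ^ 3) ^ 2 = 1 := by rw [div_pow, h, ← pow_mul, hζ, div_one]
    fin_cases i
    · simpa [rhoC, chart, chartValue, mul_comm] using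
        (HasValue.const _ ζ).mul (hasValue_infty_inv_x hQ)
    · have hy : rhoField ζ hζ (yFun p / xFun p ^ 3) =
          algebraMap (Fbar p) _ (ζ ^ 3) * (yFun p / xFun p ^ 3) := by
        simp only [map_div₀, map_pow, rhoField_x, rhoField_y, map_inv₀]
        field_simp
      have hs := (HasValue.const _ (ζ ^ 3)).mul (hasValue_infty_y_div hQ)
      rw [mul_div_cancel₀ _ (pow_ne_zero 3 hζ0), ← hy] at hs
      simpa [rhoC, chart, chartValue] using hs

theorem hasOrd_rhoField_uniformizer (P : CPoint p) :
    HasOrd (rhoC ζ hζ P) (rhoField ζ hζ (uniformizer P)) 1 := by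
  have hζ0 := ne_zero_of_pow_eq_one hζ (by norm_num)
  cases P with
  | affine a b h =>
    have hQ : b ^ 2 = (ζ * a) ^ 6 + 1 := by rw [mul_pow, hζ, one_mul, h]
    by_cases hb : b = 0
    · simpa [rhoC, uniformizer, hb] using hasOrd_y hQ hb
    · have hfactor : rhoField ζ hζ (uniformizer (.affine a b h)) =
          (xFun p - algebraMap (Fbar p) _ (ζ * a)) * algebraMap (Fbar p) _ ζ⁻¹ := by
        have hζ0' : algebraMap (Fbar p) (FunctionField p) ζ ≠ 0 := by simpa using hζ0
        simp only [uniformizer, hb, if_false, map_sub, rhoField_x, rhoField_algebraMap,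
          map_inv₀, map_mul]
        field_simp
      rw [hfactor]
      exact (hasOrd_x_sub hQ hb).mul (.of_hasValue (.const _ ζ⁻¹) (inv_ne_zero hζ0))
  | infty s h =>
    have hQ : (s / ζ ^ 3) ^ 2 = 1 := by rw [div_pow, h, ← pow_mul, hζ, div_one]
    simpa [rhoC, uniformizer, mul_comm] using
      (HasOrd.of_hasValue (.const _ ζ) hζ0).mul (hasOrd_infty_x hQ).inv

end rho

theorem hasValue_frobField_chart (P : CPoint p) (i : Fin 2) :
    HasValue (frobC p P) (frobField p (chart p P i)) (frobenius _ p (chartValue p P i)) := by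
  have hp := (Fact.out : p.Prime).ne_zero
  cases P with
  | affine a b h =>
    fin_cases i
    · simpa [frobC, chart, chartValue, frobenius_def] using hasValue_x _
    · simpa [frobC, chart, chartValue, frobenius_def] using hasValue_y _
  | infty s h =>
    fin_cases i
    · simpa [frobC, chart, chartValue, frobenius_def, hp] using hasValue_infty_inv_x _
    · simpa [frobC, chart, chartValue, frobenius_def] using hasValue_infty_y_div _

theorem hasOrd_frobField_uniformizer (P : CPoint p) :
    HasOrd (frobC p P) (frobField p (uniformizer P)) 1 := by
  have hp := (Fact.out : p.Prime).ne_zero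
  cases P with
  | affine a b h =>
    have hQ : (b ^ p) ^ 2 = (a ^ p) ^ 6 + 1 := by
      simpa only [add_pow_char, one_pow, pow_right_comm _ p] using congrArg (· ^ p) h
    by_cases hb : b = 0
    · simpa [frobC, uniformizer, hb] using hasOrd_y hQ (by simp [hb, hp])
    · simpa [frobC, uniformizer, hb] using hasOrd_x_sub hQ (by simp [hb])
  | infty s h => simpa [frobC, uniformizer] using (hasOrd_infty_x (s := s ^ p) _).inv

theorem mapDomain_mem_principal {α : CPoint p → CPoint p} (hα : Function.Bijective α)
    {f : FunctionField p →+* FunctionField p}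
    (hf : ∀ {P φ n}, HasOrd P φ n → HasOrd (α P) (f φ) n) {D : Divisor p}
    (hD : D ∈ Principal p) : D.mapDomain α ∈ Principal p := by
  obtain ⟨φ, hφ, hord⟩ := hD
  refine ⟨f φ, (map_ne_zero f).2 hφ, fun Q => ?_⟩
  obtain ⟨P, rfl⟩ := hα.2 Q
  rw [Finsupp.mapDomain_apply hα.1]
  exact hf (hord P)

theorem mapDomain_chiC_mem_principal {D : Divisor p} (hD : D ∈ Principal p) :
    D.mapDomain (chiC p) ∈ Principal p :=
  mapDomain_mem_principal chiC_involutive.bijective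
    (.map (σ := RingHom.id _) (by simp) (hasValue_chiField_chart _)
      (hasOrd_chiField_uniformizer _)) hD

theorem mapDomain_rhoC_mem_principal {ζ : Fbar p} (hζ : ζ ^ 6 = 1) {D : Divisor p}
    (hD : D ∈ Principal p) : D.mapDomain (rhoC ζ hζ) ∈ Principal p :=
  mapDomain_mem_principal (rhoC_bijective hζ)
    (.map (σ := RingHom.id _) (by simp) (hasValue_rhoField_chart hζ _)
      (hasOrd_rhoField_uniformizer hζ _)) hD

theorem mapDomain_frobC_mem_principal {D : Divisor p} (hD : D ∈ Principal p) :
    D.mapDomain (frobC p) ∈ Principal p :=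
  mapDomain_mem_principal ⟨frobC_injective, frobC_surjective⟩
    (.map (σ := frobenius _ p) (by simp [frobenius_def]) (hasValue_frobField_chart _)
      (hasOrd_frobField_uniformizer _)) hD

theorem induced_mk {G : Type*} [AddCommGroup G] {F : DivisorZero p →+ G}
    (hF : (Principal p).addSubgroupOf (DivisorZero p) ≤ F.ker) (D : DivisorZero p) :
    induced F (QuotientAddGroup.mk D) = F D := by
  rw [induced, dif_pos hF, QuotientAddGroup.lift_mk]

theorem inducedEnd_mk {α : CPoint p → CPoint p}
    (hα : ∀ D ∈ Principal p, D.mapDomain α ∈ Principal p) (D : DivisorZero p) :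
    inducedEnd α (QuotientAddGroup.mk D) = QuotientAddGroup.mk (pushDivisor α D) :=
  induced_mk (F := (QuotientAddGroup.mk' _).comp (pushDivisor α))
    (fun D' hD' => (QuotientAddGroup.eq_zero_iff (pushDivisor α D')).2 (hα _ hD')) D

end

/-! ### Pull-back of functions along `f` -/

section

open WeierstrassCurve.Affine

variable {p : ℕ} [Fact p.Prime]

variable (p) in
/-- The curve `E` over `𝔽̄_p`. -/
abbrev EBar : WeierstrassCurve.Affine (Fbar p) := ((E p).baseChange (Fbar p)).toAffine

theorem EBar_polynomial : (EBar p).polynomial = X ^ 2 - C (X ^ 3 + 1) := by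
  simp [WeierstrassCurve.Affine.polynomial, E, WeierstrassCurve.baseChange, WeierstrassCurve.map]

@[simp]
theorem EBar_negY (x y : Fbar p) : (EBar p).negY x y = -y := by
  simp [E, WeierstrassCurve.baseChange, WeierstrassCurve.map, WeierstrassCurve.Affine.negY]

variable (p) in
/-- The homomorphism of coordinate rings given by `f : C → E`. -/
def fRing : (EBar p).CoordinateRing →+* CoordRing p :=
  AdjoinRoot.lift (aeval (AdjoinRoot.of _ X ^ 2)).toRingHom (AdjoinRoot.root _) (by
    have hroot := AdjoinRoot.eval₂_root (X ^ 2 - C (X ^ 6 + 1) : (Fbar p)[X][X])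
    rw [eval₂_sub, eval₂_pow, eval₂_X, eval₂_C] at hroot
    rw [EBar_polynomial, eval₂_sub, eval₂_pow, eval₂_X, eval₂_C, ← hroot]
    simp [← pow_mul])

theorem fRing_C (g : (Fbar p)[X]) :
    fRing p (CoordinateRing.mk _ (C g)) = aeval (AdjoinRoot.of _ X ^ 2) g := by
  rw [fRing, CoordinateRing.mk, AdjoinRoot.lift_mk, eval₂_C]
  rfl

theorem fRing_Y : fRing p (CoordinateRing.mk _ X) = AdjoinRoot.root _ := by
  rw [fRing, CoordinateRing.mk, AdjoinRoot.lift_mk, eval₂_X]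

theorem fRing_XClass (c : Fbar p) :
    fRing p (CoordinateRing.XClass _ c) = AdjoinRoot.of _ X ^ 2 - algebraMap (Fbar p) _ c := by
  rw [CoordinateRing.XClass, fRing_C, map_sub, aeval_X, aeval_C]

theorem fRing_YClass (g : (Fbar p)[X]) :
    fRing p (CoordinateRing.YClass _ g) =
      AdjoinRoot.root _ - aeval (AdjoinRoot.of _ X ^ 2) g := by
  rw [CoordinateRing.YClass, map_sub, map_sub, fRing_C, fRing_Y]

theorem coordRing_induction {motive : CoordRing p → Prop}
    (const : ∀ c, motive (algebraMap (Fbar p) _ c))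
    (add : ∀ r s, motive r → motive s → motive (r + s))
    (mul_x : ∀ r, motive r → motive (r * AdjoinRoot.of _ X))
    (mul_y : ∀ r, motive r → motive (r * AdjoinRoot.root _)) (r : CoordRing p) : motive r := by
  induction r using AdjoinRoot.induction_on with
  | ih g =>
    induction g using Polynomial.induction_on with
    | C g =>
      induction g using Polynomial.induction_on with
      | C c => exact const c
      | add g g' hg hg' => simpa using add _ _ hg hg'
      | monomial n c hn => simpa [pow_succ, ← mul_assoc] using mul_x _ hn
    | add g g' hg hg' => simpa using add _ _ hg hg'
    | monomial n c hn => simpa [pow_succ, ← mul_assoc] using mul_y _ hn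

variable [Fact (p ≠ 2)] [Fact (p % 3 = 2)]

instance isElliptic_EBar : WeierstrassCurve.IsElliptic (EBar p) := by
  have hΔ : WeierstrassCurve.Δ (EBar p) = -(2 ^ 4 * 3 ^ 3) := by
    simp only [WeierstrassCurve.Δ, WeierstrassCurve.b₂, WeierstrassCurve.b₄, WeierstrassCurve.b₆,
      WeierstrassCurve.b₈, E, WeierstrassCurve.baseChange, WeierstrassCurve.map, map_zero, map_one]
    norm_num
  exact ⟨by simp [hΔ, isUnit_iff_ne_zero, two_ne_zero_Fbar, three_ne_zero_Fbar]⟩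

theorem fRing_injective : Function.Injective (fRing p) := by
  have : Module.Finite (Fbar p)[X] (EBar p).CoordinateRing :=
    .of_basis (CoordinateRing.basis (EBar p))
  refine injective_of_injective_comp_algebraMap (R := (Fbar p)[X]) _
    ((injective_iff_map_eq_zero _).2 fun g hg => ?_)
  have htr : Transcendental (Fbar p) (xFun p ^ 2) := fun h =>
    transcendental_xFun (p := p) (h.of_pow two_pos)
  refine transcendental_iff.1 htr g ?_
  have hg0 : aeval (AdjoinRoot.of (X ^ 2 - C (X ^ 6 + 1) : (Fbar p)[X][X]) X ^ 2) g = 0 :=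
    (fRing_C g).symm.trans hg
  rw [xFun, ← map_pow, aeval_algebraMap_apply, hg0, map_zero]

theorem algebraMap_comp_fRing_injective :
    Function.Injective ((algebraMap (CoordRing p) (FunctionField p)).comp (fRing p)) := by
  rw [RingHom.coe_comp]
  exact (IsFractionRing.injective (CoordRing p) (FunctionField p)).comp fRing_injective

variable (p) in
/-- The pull-back of functions by `f : C → E`. -/
def fField : (EBar p).FunctionField →+* FunctionField p :=
  IsFractionRing.lift algebraMap_comp_fRing_injective

theorem fField_algebraMap (r : (EBar p).CoordinateRing) :
    fField p (algebraMap _ _ r) = algebraMap _ _ (fRing p r) :=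
  IsFractionRing.lift_algebraMap ..

theorem fField_XClass (c : Fbar p) :
    fField p (algebraMap _ _ (CoordinateRing.XClass (EBar p) c)) =
      xFun p ^ 2 - algebraMap (Fbar p) _ c := by
  rw [fField_algebraMap, fRing_XClass, map_sub, map_pow, xFun,
    ← IsScalarTower.algebraMap_apply (Fbar p) (CoordRing p)]

theorem fField_YClass (g : (Fbar p)[X]) :
    fField p (algebraMap _ _ (CoordinateRing.YClass (EBar p) g)) =
      yFun p - aeval (xFun p ^ 2) g := by
  rw [fField_algebraMap, fRing_YClass, map_sub, ← aeval_algebraMap_apply, map_pow]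
  rfl

theorem hasValue_algebraMap {a b : Fbar p} (h : b ^ 2 = a ^ 6 + 1) (r : CoordRing p) :
    HasValue (.affine a b h) (algebraMap _ _ r) (coordHom (RingHom.id _) a b h r) := by
  induction r using coordRing_induction with
  | const c =>
    rw [coordHom_algebraMap]
    exact HasValue.const (.affine a b h) c
  | add r s hr hs => simpa using hr.add hs
  | mul_x r hr => simpa [xFun] using hr.mul (hasValue_x h)
  | mul_y r hr => simpa [yFun] using hr.mul (hasValue_y h)

theorem isUnitAt_fRing {a b : Fbar p} (h : b ^ 2 = a ^ 6 + 1) {r : (EBar p).CoordinateRing}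
    (hr : r ∉ CoordinateRing.XYIdeal _ (a ^ 2) (C b)) :
    IsUnitAt (.affine a b h) (algebraMap _ _ (fRing p r)) := by
  refine (hasValue_algebraMap h (fRing p r)).isUnitAt fun hzero => hr ?_
  have hE : (EBar p).Equation (a ^ 2) b := (E_equation_iff _ _).2 (by rw [h]; ring)
  let evalAt : (EBar p).CoordinateRing →+* Fbar p :=
    (coordHom (RingHom.id _) a b h).comp (fRing p)
  have hle : CoordinateRing.XYIdeal (EBar p) (a ^ 2) (C b) ≤ RingHom.ker evalAt := by
    rw [CoordinateRing.XYIdeal, Ideal.span_le]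
    rintro r (rfl | rfl)
    · simp [evalAt, RingHom.mem_ker, fRing_XClass]
    · simp [evalAt, RingHom.mem_ker, fRing_YClass]
  rw [(XYIdeal_isMaximal hE).eq_of_le (RingHom.ker_ne_top evalAt) hle]
  exact hzero

end

/-! ### The fibres of `f` and `f'` -/

section

open WeierstrassCurve.Affine

variable {p : ℕ} [Fact p.Prime]

variable (p) in
/-- The involution `(x, y) ↦ (-x, y)` of `C`. -/
def iota : CPoint p → CPoint p := rhoC (-1) (by norm_num)

theorem iota_affine {a b : Fbar p} (h : b ^ 2 = a ^ 6 + 1) :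
    iota p (.affine a b h) = .affine (-a) b (by rw [h]; ring) := by
  simp [iota, rhoC]

theorem iota_infty {s : Fbar p} (h : s ^ 2 = 1) :
    iota p (.infty s h) = .infty (-s) (by rw [neg_sq, h]) := by
  simp only [iota, rhoC, CPoint.infty.injEq]
  rw [Odd.neg_one_pow (by decide), div_neg, div_one]

theorem iota_involutive : Function.Involutive (iota p) :=
  rhoC_rhoC_of_mul_eq_one _ _ (by norm_num)

/-- The fibre of `f` through a point of `C`, counted with multiplicities. -/
def fibre (P : CPoint p) : Divisor p := Finsupp.single P 1 + Finsupp.single (iota p P) 1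

theorem fibre_iota (P : CPoint p) : fibre (iota p P) = fibre P := by
  rw [fibre, fibre, iota_involutive, add_comm]

open Classical in
theorem fibre_self (P : CPoint p) : fibre P P = if iota p P = P then 2 else 1 := by
  rw [fibre, Finsupp.add_apply, Finsupp.single_eq_same, Finsupp.single_apply]
  split_ifs <;> rfl

theorem fibre_self_ne_zero (P : CPoint p) : fibre P P ≠ 0 := by
  rw [fibre_self]
  split_ifs <;> norm_num

variable [Fact (p ≠ 2)]

theorem neg_eq_self_iff_Fbar {a : Fbar p} : -a = a ↔ a = 0 := by
  rw [neg_eq_iff_add_eq_zero, ← two_mul, mul_eq_zero, or_iff_right (two_ne_zero_Fbar p)]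

theorem fibre_self_affine {a b : Fbar p} (h : b ^ 2 = a ^ 6 + 1) :
    fibre (.affine a b h) (.affine a b h) = if a = 0 then 2 else 1 := by
  simp [fibre_self, iota_affine, neg_eq_self_iff_Fbar]

theorem fibre_self_infty {s : Fbar p} (h : s ^ 2 = 1) :
    fibre (.infty s h) (.infty s h) = 1 := by
  rw [fibre_self, iota_infty, if_neg]
  rw [CPoint.infty.injEq, neg_eq_self_iff_Fbar]
  exact ne_zero_of_pow_eq_one h two_ne_zero

variable [Fact (p % 3 = 2)]

theorem fMap_iota (P : CPoint p) : fMap p (iota p P) = fMap p P := by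
  cases P with
  | affine a b h => simp [iota_affine, fMap, ePoint]
  | infty s h => simp [iota_infty, fMap]

theorem fMap_eq_fMap_iff {P Q : CPoint p} : fMap p P = fMap p Q ↔ P = Q ∨ P = iota p Q := by
  refine ⟨fun h => ?_, ?_⟩
  · rcases P with ⟨a, b, hP⟩ | ⟨s, hP⟩ <;> rcases Q with ⟨a', b', hQ⟩ | ⟨s', hQ⟩
    · simp only [fMap, ePoint, Point.some.injEq] at h
      simpa only [iota_affine, CPoint.affine.injEq, h.2, and_true] using
        sq_eq_sq_iff_eq_or_eq_neg.1 h.1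
    · simp [fMap, ePoint] at h
    · simp [fMap, ePoint] at h
    · simpa only [iota_infty, CPoint.infty.injEq] using
        sq_eq_sq_iff_eq_or_eq_neg.1 (hP.trans hQ.symm)
  · rintro (rfl | rfl)
    · rfl
    · exact fMap_iota Q

theorem fMap_surjective : Function.Surjective (fMap p) := by
  rintro (_ | ⟨x, y, h⟩)
  · exact ⟨.infty 1 (one_pow 2), rfl⟩
  · obtain ⟨a, rfl⟩ := IsAlgClosed.exists_pow_nat_eq x two_pos
    exact ⟨.affine a y (((E_equation_iff _ _).1 h.1).trans (by ring)), rfl⟩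

theorem hasOrd_infty_y {s : Fbar p} (h : s ^ 2 = 1) : HasOrd (.infty s h) (yFun p) (-3) := by
  have hunit : HasOrd (.infty s h) (yFun p / xFun p ^ 3) 0 :=
    .of_hasValue (hasValue_infty_y_div h) (ne_zero_of_pow_eq_one h two_ne_zero)
  have hmul := hunit.mul ((hasOrd_infty_x h).zpow 3)
  rwa [show xFun p ^ (3 : ℤ) = xFun p ^ 3 from zpow_natCast _ 3,
    div_mul_cancel₀ _ (pow_ne_zero 3 xFun_ne_zero)] at hmul

theorem hasOrd_uniformizerE (P : CPoint p) :
    HasOrd P (uniformizerE (xFun p ^ 2) (yFun p) (fMap p P)) (fibre P P) := by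
  cases P with
  | infty s h =>
    rw [fibre_self_infty]
    exact ((hasOrd_infty_x h).zpow 2).div (hasOrd_infty_y h)
  | affine a b h =>
    rw [fibre_self_affine]
    simp only [fMap, ePoint, uniformizerE]
    by_cases hb : b = 0
    · have ha : a ≠ 0 := by
        rintro rfl
        simp [hb] at h
      simpa [ha, hb] using hasOrd_y h hb
    · have hfactor : xFun p ^ 2 - algebraMap (Fbar p) _ (a ^ 2) =
          (xFun p - algebraMap (Fbar p) _ a) * (xFun p + algebraMap (Fbar p) _ a) := by
        rw [map_pow]; ring
      rw [if_neg hb, hfactor]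
      split_ifs with ha
      · have hadd : xFun p + algebraMap (Fbar p) _ a = xFun p - algebraMap (Fbar p) _ a := by
          simp [ha]
        rw [hadd]
        exact (hasOrd_x_sub h hb).mul (hasOrd_x_sub h hb)
      · refine (hasOrd_x_sub h hb).mul (.of_hasValue ((hasValue_x h).add (HasValue.const _ a)) ?_)
        rw [← two_mul]
        exact mul_ne_zero (two_ne_zero_Fbar p) ha

theorem isPullback_fibre (P : CPoint p) :
    IsPullback (fMap p) (xFun p ^ 2) (yFun p) (fMap p P) (fibre P) := by
  refine fun Q => ⟨fun h => ?_, fun h => ?_⟩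
  · have hfibre : fibre P = fibre Q := by
      rcases fMap_eq_fMap_iff.1 h with rfl | rfl
      · rfl
      · rw [fibre_iota]
    rw [← h, hfibre]
    exact hasOrd_uniformizerE Q
  · have hP : Q ≠ P := by
      rintro rfl
      exact h rfl
    have hιP : Q ≠ iota p P := by
      rintro rfl
      exact h (fMap_iota P)
    rw [fibre, Finsupp.add_apply, Finsupp.single_eq_of_ne hP, Finsupp.single_eq_of_ne hιP, add_zero]

theorem IsPullback.unique {g : CPoint p → EPoint p} {U V : FunctionField p} {P : EPoint p}
    {D D' : Divisor p} (h : IsPullback g U V P D) (h' : IsPullback g U V P D') : D = D' := by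
  ext Q
  by_cases hQ : g Q = P
  · exact ((h Q).1 hQ).unique ((h' Q).1 hQ)
  · rw [(h Q).2 hQ, (h' Q).2 hQ]

theorem IsPullback.pullback_eq {g : CPoint p → EPoint p} {U V : FunctionField p} {P : EPoint p}
    {D : Divisor p} (h : IsPullback g U V P D) : pullback g U V P = D := by
  have hex : ∃ D, IsPullback g U V P D := ⟨D, h⟩
  rw [pullback, dif_pos hex]
  exact hex.choose_spec.unique h

theorem fPull_fMap (P : CPoint p) : fPull (fMap p P) = fibre P :=
  (isPullback_fibre P).pullback_eq

theorem isPullback_fPull (P : EPoint p) :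
    IsPullback (fMap p) (xFun p ^ 2) (yFun p) P (fPull P) := by
  obtain ⟨Q, rfl⟩ := fMap_surjective P
  rw [fPull_fMap]
  exact isPullback_fibre Q

theorem fMap_chiC (P : CPoint p) : fMap p (chiC p P) = fMap' p P := by
  cases P with
  | affine a b h => by_cases ha : a = 0 <;> simp [chiC, fMap, fMap', ha]
  | infty s h => simp [chiC, fMap, fMap']

theorem fMap'_chiC (P : CPoint p) : fMap' p (chiC p P) = fMap p P := by
  rw [← fMap_chiC, chiC_involutive]

theorem isPullback_mapDomain_chiC (P : EPoint p) :
    IsPullback (fMap' p) (1 / xFun p ^ 2) (yFun p / xFun p ^ 3) P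
      ((fPull P).mapDomain (chiC p)) := by
  intro Q
  obtain ⟨Q, rfl⟩ := chiC_involutive.surjective Q
  rw [fMap'_chiC, Finsupp.mapDomain_apply chiC_involutive.injective]
  refine ⟨fun h => ?_, (isPullback_fPull P Q).2⟩
  have hχ := HasOrd.map (σ := RingHom.id _) (by simp) (hasValue_chiField_chart Q)
    (hasOrd_chiField_uniformizer Q) ((isPullback_fPull P Q).1 h)
  convert hχ using 1
  cases P with
  | zero => simp [uniformizerE]
  | some x y h => simp only [uniformizerE]; split_ifs <;> simp

theorem fPull'_eq (P : EPoint p) : fPull' P = (fPull P).mapDomain (chiC p) :=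
  (isPullback_mapDomain_chiC P).pullback_eq

theorem isPullback_fPull' (P : EPoint p) :
    IsPullback (fMap' p) (1 / xFun p ^ 2) (yFun p / xFun p ^ 3) P (fPull' P) := by
  rw [fPull'_eq]
  exact isPullback_mapDomain_chiC P

theorem ord_XClass_self {x y : Fbar p} (h : (EBar p).Nonsingular x y) :
    ord (pointPrime h) (algebraMap _ (EBar p).FunctionField (CoordinateRing.XClass (EBar p) x)) =
      if y = 0 then 2 else 1 := by
  simp only [ord_XClass h h, if_true, Point.neg_some, Point.some.injEq, true_and, EBar_negY,
    neg_eq_self_iff_Fbar]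
  split_ifs <;> rfl

theorem exists_ord_eq_one_and_fField_eq_uniformizerE {x y : Fbar p}
    (h : (EBar p).Nonsingular x y) :
    ∃ t : (EBar p).FunctionField, t ≠ 0 ∧ ord (pointPrime h) t = 1 ∧
      fField p t = uniformizerE (xFun p ^ 2) (yFun p) (.some x y h) := by
  by_cases hy : y = 0
  · refine ⟨algebraMap _ _ (CoordinateRing.YClass (EBar p) (C y)),
      by simpa using CoordinateRing.YClass_ne_zero _, ord_YClass_eq_one h ?_, ?_⟩
    · simp [ord_XClass_self, hy]
    · simp [fField_YClass, uniformizerE, hy]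
  · exact ⟨algebraMap _ _ (CoordinateRing.XClass (EBar p) x),
      by simpa using CoordinateRing.XClass_ne_zero x,
      by rw [ord_XClass_self, if_neg hy], by simp [fField_XClass, uniformizerE, hy]⟩

theorem hasOrd_fField {P : CPoint p} {x y : Fbar p} {h : (EBar p).Nonsingular x y}
    (hP : fMap p P = .some x y h) {ψ : (EBar p).FunctionField} (hψ : ψ ≠ 0) :
    HasOrd P (fField p ψ) (ord (pointPrime h) ψ * fibre P P) := by
  obtain ⟨t, ht0, ht1, ht⟩ := exists_ord_eq_one_and_fField_eq_uniformizerE h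
  have htord := hasOrd_uniformizerE P
  rw [hP, ← ht] at htord
  obtain ⟨r, s, hr, hs, hψ_eq⟩ := exists_eq_zpow_ord_mul _ ht0 ht1 hψ
  conv_lhs => rw [hψ_eq]
  rw [map_mul, map_zpow₀, map_div₀, fField_algebraMap, fField_algebraMap]
  cases P with
  | infty s h' => simp [fMap] at hP
  | affine a b h' =>
    simp only [fMap, ePoint, Point.some.injEq] at hP
    obtain ⟨rfl, rfl⟩ := hP
    have hunit := HasOrd.of_isUnitAt ((isUnitAt_fRing h' hr).mul (isUnitAt_fRing h' hs).inv)
    simpa only [add_zero, ← div_eq_mul_inv] using (htord.zpow (ord (pointPrime h) ψ)).mul hunit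

end

/-! ### Push-forward of divisors along `f` and `f'` -/

section

open WeierstrassCurve.Affine

variable {p : ℕ} [Fact p.Prime]

theorem exists_eq_fRing_add (r : CoordRing p) :
    ∃ s t : (EBar p).CoordinateRing, r = fRing p s + AdjoinRoot.of _ X * fRing p t := by
  induction r using coordRing_induction with
  | const c => exact ⟨CoordinateRing.mk _ (C (C c)), 0, by rw [fRing_C, aeval_C, map_zero]; ring⟩
  | add r r' hr hr' =>
    obtain ⟨s, t, rfl⟩ := hr
    obtain ⟨s', t', rfl⟩ := hr'
    exact ⟨s + s', t + t', by simp only [map_add]; ring⟩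
  | mul_x r hr =>
    obtain ⟨s, t, rfl⟩ := hr
    exact ⟨CoordinateRing.mk _ (C X) * t, s, by rw [map_mul, fRing_C, aeval_X]; ring⟩
  | mul_y r hr =>
    obtain ⟨s, t, rfl⟩ := hr
    exact ⟨CoordinateRing.mk _ X * s, CoordinateRing.mk _ X * t, by
      rw [map_mul, map_mul, fRing_Y]; ring⟩

variable [Fact (p ≠ 2)] [Fact (p % 3 = 2)]

variable (p) in
/-- The pull-back of functions by `(x, y) ↦ (-x, y)`. -/
def iotaField : FunctionField p →+* FunctionField p := rhoField (-1) (by norm_num)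

theorem hasOrd_iota {P : CPoint p} {φ : FunctionField p} {n : ℤ} (hφ : HasOrd P φ n) :
    HasOrd (iota p P) (iotaField p φ) n :=
  .map (σ := RingHom.id _) (rhoField_algebraMap _) (hasValue_rhoField_chart _ P)
    (hasOrd_rhoField_uniformizer _ P) hφ

theorem iotaField_xFun : iotaField p (xFun p) = -xFun p := by
  simp [iotaField, inv_neg]

theorem iotaField_fRing (r : (EBar p).CoordinateRing) :
    iotaField p (algebraMap _ _ (fRing p r)) = algebraMap _ _ (fRing p r) := by
  suffices heq : ((iotaField p).comp (algebraMap _ _)).comp (fRing p) =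
      (algebraMap (CoordRing p) (FunctionField p)).comp (fRing p) from RingHom.congr_fun heq r
  refine Ideal.Quotient.ringHom_ext (Polynomial.ringHom_ext' (Polynomial.ringHom_ext' ?_ ?_) ?_)
  · ext c
    change iotaField p (algebraMap _ _ (fRing p (CoordinateRing.mk _ (C (C c))))) =
      algebraMap _ _ (fRing p (CoordinateRing.mk _ (C (C c))))
    rw [fRing_C, aeval_C]
    exact rhoField_algebraMap _ c
  · change iotaField p (algebraMap _ _ (fRing p (CoordinateRing.mk _ (C X)))) =
      algebraMap _ _ (fRing p (CoordinateRing.mk _ (C X)))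
    rw [fRing_C, aeval_X, map_pow, map_pow]
    exact (congrArg (· ^ 2) iotaField_xFun).trans (neg_sq _)
  · change iotaField p (algebraMap _ _ (fRing p (CoordinateRing.mk _ X))) =
      algebraMap _ _ (fRing p (CoordinateRing.mk _ X))
    rw [fRing_Y]
    exact rhoField_y _

theorem exists_mul_iotaField_algebraMap_eq (r : CoordRing p) :
    ∃ s : (EBar p).CoordinateRing, algebraMap _ (FunctionField p) r *
      iotaField p (algebraMap _ _ r) = fField p (algebraMap _ _ s) := by
  obtain ⟨s, t, rfl⟩ := exists_eq_fRing_add r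
  refine ⟨s ^ 2 - CoordinateRing.mk _ (C X) * t ^ 2, ?_⟩
  rw [fField_algebraMap, map_sub, map_mul, map_pow, map_pow, fRing_C, aeval_X]
  simp only [map_add, map_mul, map_sub, map_pow, iotaField_fRing]
  change (_ + xFun p * _) * (_ + iotaField p (xFun p) * _) = _ - xFun p ^ 2 * _
  rw [iotaField_xFun]
  ring

theorem exists_mul_iotaField_eq (φ : FunctionField p) :
    ∃ ψ, φ * iotaField p φ = fField p ψ := by
  obtain ⟨r, s, -, rfl⟩ := IsFractionRing.div_surjective (A := CoordRing p) φ
  obtain ⟨r', hr'⟩ := exists_mul_iotaField_algebraMap_eq r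
  obtain ⟨s', hs'⟩ := exists_mul_iotaField_algebraMap_eq s
  refine ⟨algebraMap _ _ r' / algebraMap _ _ s', ?_⟩
  rw [map_div₀, map_div₀, ← hr', ← hs', div_mul_div_comm]

theorem fibre_self_mul_mapDomain (D : Divisor p) (P : CPoint p) :
    fibre P P * D.mapDomain (fMap p) (fMap p P) = D P + D (iota p P) := by
  classical
  induction D using Finsupp.induction_linear with
  | zero => simp
  | add D D' h h' =>
    simp only [Finsupp.mapDomain_add, Finsupp.add_apply, mul_add, h, h']
    ring
  | single Q n =>
    rw [Finsupp.mapDomain_single, fibre_self]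
    simp only [Finsupp.single_apply, fMap_eq_fMap_iff]
    by_cases hQP : Q = P
    · subst hQP
      by_cases hfix : iota p Q = Q
      · simp [hfix, two_mul]
      · simp [hfix, Ne.symm hfix]
    · by_cases hQιP : Q = iota p P
      · have hfix : iota p P ≠ P := fun hfix => hQP (hQιP.trans hfix)
        simp [hQιP, hfix]
      · simp [hQP, hQιP]

theorem ord_eq_mapDomain_fMap_apply {D : Divisor p} {φ : FunctionField p}
    (hD : ∀ P, HasOrd P φ (D P)) {ψ : (EBar p).FunctionField} (hψ0 : ψ ≠ 0)
    (hψ : φ * iotaField p φ = fField p ψ) {x y : Fbar p} (h : (EBar p).Nonsingular x y) :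
    ord (pointPrime h) ψ = D.mapDomain (fMap p) (.some x y h) := by
  obtain ⟨P, hP⟩ := fMap_surjective (Point.some x y h)
  have hι := hasOrd_iota (hD (iota p P))
  rw [iota_involutive] at hι
  have hnorm : D P + D (iota p P) = ord (pointPrime h) ψ * fibre P P :=
    ((hD P).mul hι).unique (hψ ▸ hasOrd_fField hP hψ0)
  rw [← fibre_self_mul_mapDomain, mul_comm, hP] at hnorm
  exact (mul_right_cancel₀ (fibre_self_ne_zero P) hnorm).symm

theorem sum_fMap_eq_zero {D : Divisor p} (hD : D ∈ Principal p) :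
    D.sum (fun P n => n • fMap p P) = 0 := by
  obtain ⟨φ, hφ, h⟩ := hD
  obtain ⟨ψ, hψ⟩ := exists_mul_iotaField_eq φ
  have hψ0 : ψ ≠ 0 := by
    rintro rfl
    simp [hφ] at hψ
  have hsum := sum_smul_eq_zero_of_ord_eq (D.mapDomain (fMap p)) hψ0
    fun x y hE => ord_eq_mapDomain_fMap_apply h hψ0 hψ hE
  rwa [Finsupp.sum_mapDomain_index (by simp) (by simp [add_smul])] at hsum

/-- The homomorphism `∑ n_P P ↦ (∑ n_P f(P), ∑ n_P f'(P))` on all divisors, without the condition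
on the degree. -/
def fSum : Divisor p →+ EPoint p × EPoint p :=
  Finsupp.liftAddHom fun P => (zmultiplesHom (EPoint p × EPoint p)) (fMap p P, fMap' p P)

theorem fSum_single (P : CPoint p) (n : ℤ) :
    fSum (Finsupp.single P n) = n • (fMap p P, fMap' p P) := by
  simp [fSum]

theorem muTildeDivisor_apply (D : DivisorZero p) : muTildeDivisor p D = fSum (D : Divisor p) := by
  suffices heq : AddMonoidHom.prod
      (Finsupp.liftAddHom fun P => (zmultiplesHom (EPoint p)) (fMap p P))
      (Finsupp.liftAddHom fun P => (zmultiplesHom (EPoint p)) (fMap' p P)) = fSum (p := p) from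
    DFunLike.congr_fun heq (D : Divisor p)
  ext P <;> simp [fSum_single]

theorem fSum_mapDomain {α : CPoint p → CPoint p} {M : AddMonoid.End (EPoint p × EPoint p)}
    (h : ∀ P, (fMap p (α P), fMap' p (α P)) = M (fMap p P, fMap' p P)) (D : Divisor p) :
    fSum (D.mapDomain α) = M (fSum D) := by
  induction D using Finsupp.induction_linear with
  | zero => rw [Finsupp.mapDomain_zero, map_zero]; exact (map_zero M).symm
  | add D D' hD hD' =>
    rw [Finsupp.mapDomain_add, map_add, map_add, hD, hD']
    exact (map_add M _ _).symm
  | single P n =>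
    rw [Finsupp.mapDomain_single, fSum_single, fSum_single, h]
    exact (map_zsmul M n _).symm

theorem fSum_fst (D : Divisor p) : (fSum D).1 = D.sum (fun P n => n • fMap p P) := by
  rw [fSum, Finsupp.liftAddHom_apply, Finsupp.sum, Prod.fst_sum]
  rfl

theorem fSum_mapDomain_chiC (D : Divisor p) : fSum (D.mapDomain (chiC p)) = (fSum D).swap :=
  fSum_mapDomain (M := AddEquiv.prodComm.toAddMonoidHom)
    (fun P => by rw [fMap_chiC, fMap'_chiC]; rfl) D

theorem fSum_eq_zero {D : Divisor p} (hD : D ∈ Principal p) : fSum D = 0 := by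
  have hfst := sum_fMap_eq_zero hD
  have hsnd := sum_fMap_eq_zero (mapDomain_chiC_mem_principal hD)
  rw [← fSum_fst] at hfst hsnd
  rw [fSum_mapDomain_chiC] at hsnd
  exact Prod.ext hfst hsnd

theorem muTilde_mk (D : DivisorZero p) :
    muTilde p (QuotientAddGroup.mk D) = muTildeDivisor p D := by
  refine induced_mk (fun D hD => ?_) D
  rw [AddMonoidHom.mem_ker, muTildeDivisor_apply]
  exact fSum_eq_zero hD

end

/-! ### Additivity of `μ` -/

section

open WeierstrassCurve.Affine

variable {p : ℕ} [Fact p.Prime]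

theorem divInfty_affine {a b : Fbar p} (h : b ^ 2 = a ^ 6 + 1) :
    divInfty p (.affine a b h) = 0 := by
  simp [divInfty]

theorem degree_single (P : CPoint p) (n : ℤ) : degree p (Finsupp.single P n) = n := by
  simp [degree]

theorem degree_mapDomain (α : CPoint p → CPoint p) (D : Divisor p) :
    degree p (D.mapDomain α) = degree p D := by
  suffices heq : (degree p).comp (Finsupp.mapDomain.addMonoidHom α) = degree p from
    DFunLike.congr_fun heq D
  exact Finsupp.addHom_ext fun P n => by simp [degree_single]

variable [Fact (p ≠ 2)] [Fact (p % 3 = 2)]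

theorem fPull_apply (P : EPoint p) (Q : CPoint p) :
    fPull P Q = if fMap p Q = P then fibre Q Q else 0 := by
  split_ifs with h
  · rw [← h, fPull_fMap]
  · exact (isPullback_fPull P Q).2 h

theorem fPull_zero : fPull (0 : EPoint p) = divInfty p := by
  have h := fPull_fMap (p := p) (.infty 1 (one_pow 2))
  rwa [fibre, iota_infty] at h

theorem fPull_zero_infty {s : Fbar p} (h : s ^ 2 = 1) : fPull 0 (.infty s h) = 1 := by
  rw [fPull_apply, fMap, if_pos rfl, fibre_self_infty]

theorem fPull_infty_of_ne_zero {P : EPoint p} (hP : P ≠ 0) {s : Fbar p} (h : s ^ 2 = 1) :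
    fPull P (.infty s h) = 0 := by
  rw [fPull_apply, fMap, if_neg hP.symm]

theorem mem_principal_of_ord_eq {D : Divisor p} {ψ : (EBar p).FunctionField} (hψ : ψ ≠ 0)
    (hD : ∀ (P : CPoint p) (x y : Fbar p) (h : (EBar p).Nonsingular x y),
      fMap p P = .some x y h → D P = ord (pointPrime h) ψ * fibre P P)
    (hinf : ∀ (s : Fbar p) (h : s ^ 2 = 1),
      HasOrd (.infty s h) (fField p ψ) (D (.infty s h))) : D ∈ Principal p := by
  refine ⟨fField p ψ, (_root_.map_ne_zero _).2 hψ, fun P => ?_⟩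
  cases P with
  | infty s h => exact hinf s h
  | affine a b h =>
    rw [hD (.affine a b h) _ _ _ rfl]
    exact hasOrd_fField rfl hψ

theorem hasOrd_infty_x_sq_sub {s : Fbar p} (h : s ^ 2 = 1) (c : Fbar p) :
    HasOrd (.infty s h) (xFun p ^ 2 - algebraMap (Fbar p) _ c) (-2) := by
  have hx := xFun_ne_zero (p := p)
  have hvalue := (HasValue.one (.infty s h)).sub
    ((HasValue.const _ c).mul ((hasValue_infty_inv_x h).pow 2))
  have hord := ((hasOrd_infty_x h).zpow 2).mul (.of_hasValue hvalue (by simp))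
  convert hord using 1
  · norm_cast
    field_simp
  · norm_num

theorem hasOrd_infty_y_sub_line {s : Fbar p} (h : s ^ 2 = 1) (c d e : Fbar p) :
    HasOrd (.infty s h) (yFun p - (algebraMap (Fbar p) _ e *
      (xFun p ^ 2 - algebraMap (Fbar p) _ c) + algebraMap (Fbar p) _ d)) (-3) := by
  have hx := xFun_ne_zero (p := p)
  have hx' := hasValue_infty_inv_x h
  have hvalue := ((hasValue_infty_y_div h).sub ((HasValue.const _ e).mul hx')).add
    ((HasValue.const _ (e * c - d)).mul (hx'.pow 3))
  have hord := ((hasOrd_infty_x h).zpow 3).mul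
    (.of_hasValue hvalue (by simpa using ne_zero_of_pow_eq_one h two_ne_zero))
  convert hord using 1
  · norm_cast
    simp only [map_sub, map_mul]
    field_simp
    ring
  · norm_num

theorem fField_linePolynomial (x y l : Fbar p) :
    fField p (algebraMap _ _ (CoordinateRing.YClass (EBar p) (linePolynomial x y l))) =
      yFun p - (algebraMap (Fbar p) _ l * (xFun p ^ 2 - algebraMap (Fbar p) _ x) +
        algebraMap (Fbar p) _ y) := by
  simp [fField_YClass, linePolynomial]

theorem fPull_add_fPull_neg_mem_principal {x y : Fbar p} (h : (EBar p).Nonsingular x y) :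
    fPull (.some x y h) + fPull (-.some x y h) - 2 • fPull 0 ∈ Principal p := by
  have hneg : -Point.some x y h ≠ 0 := neg_ne_zero.2 (Point.some_ne_zero h)
  refine mem_principal_of_ord_eq (ψ := algebraMap _ _ (CoordinateRing.XClass (EBar p) x))
    (by simpa using CoordinateRing.XClass_ne_zero x) (fun P x' y' h' hP => ?_) fun s hs => ?_
  · simp only [Finsupp.sub_apply, Finsupp.add_apply, Finsupp.smul_apply, fPull_apply, hP,
      ord_XClass h' h, eq_comm (a := Point.some x' y' h'), if_neg (Point.some_ne_zero h').symm]
    split_ifs <;> ring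
  · rw [fField_XClass]
    convert hasOrd_infty_x_sq_sub hs x using 1
    simp only [Finsupp.sub_apply, Finsupp.add_apply, Finsupp.smul_apply,
      fPull_infty_of_ne_zero (Point.some_ne_zero h), fPull_infty_of_ne_zero hneg, fPull_zero_infty]
    norm_num

theorem fPull_add_fPull_mem_principal_of_ne {x₁ y₁ x₂ y₂ : Fbar p}
    (h₁ : (EBar p).Nonsingular x₁ y₁) (h₂ : (EBar p).Nonsingular x₂ y₂)
    (hxy : ¬(x₁ = x₂ ∧ y₁ = (EBar p).negY x₂ y₂)) :
    fPull (.some x₁ y₁ h₁) + fPull (.some x₂ y₂ h₂) -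
      fPull (.some x₁ y₁ h₁ + .some x₂ y₂ h₂) - fPull 0 ∈ Principal p := by
  have hsum : Point.some x₁ y₁ h₁ + Point.some x₂ y₂ h₂ ≠ 0 := by
    rw [Point.add_some hxy]
    exact Point.some_ne_zero _
  have hline : algebraMap _ (EBar p).FunctionField (CoordinateRing.YClass (EBar p)
      (linePolynomial x₁ y₁ ((EBar p).slope x₁ x₂ y₁ y₂))) ≠ 0 := by
    simpa using CoordinateRing.YClass_ne_zero _
  have hvertical : algebraMap _ (EBar p).FunctionField (CoordinateRing.XClass (EBar p)
      ((EBar p).addX x₁ x₂ ((EBar p).slope x₁ x₂ y₁ y₂))) ≠ 0 := by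
    simpa using CoordinateRing.XClass_ne_zero _
  refine mem_principal_of_ord_eq (div_ne_zero hline hvertical) (fun P x y h hP => ?_)
    fun s hs => ?_
  · simp only [Finsupp.sub_apply, Finsupp.add_apply, fPull_apply, hP,
      ord_line h h₁ h₂ hxy, eq_comm (a := Point.some x y h), if_neg (Point.some_ne_zero h).symm]
    split_ifs <;> ring
  · rw [map_div₀, fField_XClass, fField_linePolynomial]
    convert (hasOrd_infty_y_sub_line hs _ _ _).div (hasOrd_infty_x_sq_sub hs _) using 1
    simp only [Finsupp.sub_apply, Finsupp.add_apply, fPull_infty_of_ne_zero (Point.some_ne_zero _),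
      fPull_infty_of_ne_zero hsum, fPull_zero_infty]
    norm_num

theorem fPull_add_mem_principal (P Q : EPoint p) :
    fPull P + fPull Q - fPull (P + Q) - fPull 0 ∈ Principal p := by
  by_cases hP : P = 0
  · simp [hP]
  by_cases hQ : Q = 0
  · simp [hQ]
  by_cases hPQ : P + Q = 0
  · rcases P with _ | ⟨x, y, h⟩
    · exact absurd rfl hP
    · rw [hPQ, eq_neg_of_add_eq_zero_right hPQ, sub_sub, ← two_nsmul]
      exact fPull_add_fPull_neg_mem_principal h
  · rcases P with _ | ⟨x₁, y₁, h₁⟩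
    · exact absurd rfl hP
    rcases Q with _ | ⟨x₂, y₂, h₂⟩
    · exact absurd rfl hQ
    · exact fPull_add_fPull_mem_principal_of_ne h₁ h₂ fun hxy =>
        hPQ (Point.add_of_Y_eq hxy.1 hxy.2)

theorem divInfty_infty {s : Fbar p} (h : s ^ 2 = 1) : divInfty p (.infty s h) = 1 := by
  rw [← fPull_zero, fPull_zero_infty]

theorem hasOrd_xFun (P : CPoint p) :
    HasOrd P (xFun p) (((divInfty p).mapDomain (chiC p) - divInfty p) P) := by
  have hχ : (divInfty p).mapDomain (chiC p) P = divInfty p (chiC p P) := by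
    conv_lhs => rw [← chiC_involutive P]
    exact Finsupp.mapDomain_apply chiC_involutive.injective _ _
  rw [Finsupp.sub_apply, hχ]
  cases P with
  | infty s h => simpa [chiC, divInfty_affine, divInfty_infty] using hasOrd_infty_x h
  | affine a b h =>
    rw [divInfty_affine]
    by_cases ha : a = 0
    · subst ha
      have hb : b ≠ 0 := by
        rintro rfl
        simp at h
      simpa [chiC, divInfty_infty] using hasOrd_x_sub h hb
    · simpa [chiC, divInfty_affine, ha] using HasOrd.of_hasValue (hasValue_x h) ha

theorem mapDomain_chiC_divInfty_mem_principal :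
    (divInfty p).mapDomain (chiC p) - divInfty p ∈ Principal p :=
  ⟨xFun p, xFun_ne_zero, hasOrd_xFun⟩

theorem muDivisor_add_mem_principal (R S : EPoint p × EPoint p) :
    muDivisor R + muDivisor S - muDivisor (R + S) ∈ Principal p := by
  have hf := fPull_add_mem_principal R.1 S.1
  have hf' := mapDomain_chiC_mem_principal (fPull_add_mem_principal R.2 S.2)
  have hx := mapDomain_chiC_divInfty_mem_principal (p := p)
  have hhom : ∀ D : Divisor p, D.mapDomain (chiC p) = Finsupp.mapDomain.addMonoidHom (chiC p) D :=
    fun _ => rfl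
  convert add_mem (add_mem hf hf') hx using 1
  simp only [muDivisor, fPull'_eq, fPull_zero, hhom, map_sub, map_add, Prod.fst_add, Prod.snd_add]
  abel

theorem degree_fPull (P : EPoint p) : degree p (fPull P) = 2 := by
  obtain ⟨Q, rfl⟩ := fMap_surjective P
  rw [fPull_fMap, fibre, map_add, degree_single, degree_single]
  rfl

theorem muDivisor_mem (R : EPoint p × EPoint p) : muDivisor R ∈ DivisorZero p := by
  rw [AddMonoidHom.mem_ker, muDivisor, fPull'_eq, ← fPull_zero, map_sub, map_add, map_nsmul,
    degree_mapDomain, degree_fPull, degree_fPull, degree_fPull]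
  rfl

theorem divisorClass_eq_mk {D : Divisor p} (h : D ∈ DivisorZero p) :
    divisorClass D = QuotientAddGroup.mk ⟨D, h⟩ := by
  rw [divisorClass, dif_pos h]

theorem divisorClass_muDivisor_add (R S : EPoint p × EPoint p) :
    divisorClass (muDivisor (R + S)) = divisorClass (muDivisor R) + divisorClass (muDivisor S) := by
  simp only [divisorClass_eq_mk (muDivisor_mem _)]
  rw [← QuotientAddGroup.mk_add, QuotientAddGroup.eq, neg_add_eq_sub]
  exact muDivisor_add_mem_principal R S

theorem mu_apply (R : EPoint p × EPoint p) :
    mu p R = QuotientAddGroup.mk ⟨muDivisor R, muDivisor_mem R⟩ := by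
  rw [mu, dif_pos divisorClass_muDivisor_add]
  exact divisorClass_eq_mk _

end

/-! ### The images of endomorphisms under `T` -/

section

open WeierstrassCurve.Affine

theorem matrixEnd_apply {A : Type*} [AddCommGroup A]
    (M : Matrix (Fin 2) (Fin 2) (AddMonoid.End A)) (a b : A) :
    matrixEnd M (a, b) = (M 0 0 a + M 0 1 b, M 1 0 a + M 1 1 b) := rfl

variable {p : ℕ} [Fact p.Prime]

theorem chiC_frobC (P : CPoint p) : chiC p (frobC p P) = frobC p (chiC p P) := by
  have hp : p ≠ 0 := (Fact.out : p.Prime).ne_zero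
  cases P with
  | affine a b h =>
    by_cases ha : a = 0
    · simp [chiC, frobC, ha, hp]
    · simp [chiC, frobC, ha, hp, div_pow, ← pow_mul, mul_comm]
  | infty s h => simp [chiC, frobC, hp]

variable [Fact (p ≠ 2)] [Fact (p % 3 = 2)]

theorem neg_ePoint {x y : Fbar p} (h : y ^ 2 = x ^ 3 + 1) :
    -ePoint x y h = ePoint x (-y) (by rw [neg_sq, h]) := by
  simp only [ePoint, Point.neg_some, EBar_negY]

theorem fMap'_iota (P : CPoint p) : fMap' p (iota p P) = -fMap' p P := by
  cases P with
  | affine a b h =>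
    by_cases ha : a = 0
    · simp [iota_affine, fMap', ha]
    · simp [iota_affine, fMap', ha, neg_ePoint, Odd.neg_pow (n := 3) (by decide) a, div_neg]
  | infty s h => simp [iota_infty, fMap', neg_ePoint]

theorem fSum_fPull (P : EPoint p) : fSum (fPull P) = (2 • P, 0) := by
  obtain ⟨Q, rfl⟩ := fMap_surjective P
  rw [fPull_fMap, fibre, map_add, fSum_single, fSum_single, one_smul, one_smul, fMap_iota,
    fMap'_iota, Prod.mk_add_mk, add_neg_cancel, two_smul]

theorem fSum_muDivisor (R : EPoint p × EPoint p) : fSum (muDivisor R) = 2 • R := by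
  rw [muDivisor, ← fPull_zero, map_sub, map_nsmul, map_add, fPull'_eq, fSum_mapDomain_chiC,
    fSum_fPull, fSum_fPull, fSum_fPull]
  ext <;> simp

theorem T_inducedEnd {α : CPoint p → CPoint p} {M : AddMonoid.End (EPoint p × EPoint p)}
    (hα : ∀ D ∈ Principal p, D.mapDomain α ∈ Principal p)
    (h : ∀ P, (fMap p (α P), fMap' p (α P)) = M (fMap p P, fMap' p P)) :
    T p (inducedEnd α) = 2 • M := by
  refine AddMonoidHom.ext fun R => ?_
  calc muTilde p (inducedEnd α (mu p R))
      = fSum ((muDivisor R).mapDomain α) := by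
        rw [mu_apply, inducedEnd_mk hα, muTilde_mk, muTildeDivisor_apply]
        rfl
    _ = 2 • M R := by rw [fSum_mapDomain h, fSum_muDivisor, map_nsmul]

theorem piE_ePoint {x y : Fbar p} (h : y ^ 2 = x ^ 3 + 1) (h' : (y ^ p) ^ 2 = (x ^ p) ^ 3 + 1) :
    piE p (ePoint x y h) = ePoint (x ^ p) (y ^ p) h' := by
  refine (Point.map_some ..).trans ?_
  simp [ePoint]

theorem fMap_frobC (P : CPoint p) : fMap p (frobC p P) = piE p (fMap p P) := by
  cases P with
  | affine a b h =>
    simp only [fMap, frobC]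
    rw [piE_ePoint _ (by rw [← pow_mul, mul_comm p 2, pow_mul, h, add_pow_char]; ring)]
    simp [ePoint, ← pow_mul, mul_comm]
  | infty s h => exact (map_zero (piE p)).symm

theorem fMap'_frobC (P : CPoint p) : fMap' p (frobC p P) = piE p (fMap' p P) := by
  rw [← fMap_chiC, ← fMap_chiC, chiC_frobC, fMap_frobC]

theorem rho3_ePoint {z : Fbar p} (hz : z ^ 3 = 1) {x y : Fbar p} (h : y ^ 2 = x ^ 3 + 1) :
    rho3 p z hz (ePoint x y h) = ePoint (z * x) y (by rw [mul_pow, hz, one_mul, h]) := rfl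

theorem fMap_rhoC {ζ : Fbar p} (hζ : IsPrimitiveRoot ζ 6) (P : CPoint p) :
    fMap p (rhoC ζ hζ.pow_eq_one P) = rho3 p (ζ ^ 2) (cube_sq_eq_one hζ) (fMap p P) := by
  cases P with
  | affine a b h => simp only [fMap, rhoC, mul_pow, rho3_ePoint]
  | infty s h => exact (map_zero (rho3 p (ζ ^ 2) (cube_sq_eq_one hζ))).symm

theorem fMap'_rhoC {ζ : Fbar p} (hζ : IsPrimitiveRoot ζ 6) (P : CPoint p) :
    fMap' p (rhoC ζ hζ.pow_eq_one P) =
      (-rho3 p (ζ ^ 2) (cube_sq_eq_one hζ) ^ 2) (fMap' p P) := by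
  have hζ₃ : ζ ^ 3 = -1 := (hζ.pow (by norm_num) (by norm_num)).eq_neg_one_of_two_right
  have hζ₀ := hζ.ne_zero (by norm_num)
  have hpow (Q : EPoint p) : (-rho3 p (ζ ^ 2) (cube_sq_eq_one hζ) ^ 2) Q =
      -rho3 p (ζ ^ 2) (cube_sq_eq_one hζ) (rho3 p (ζ ^ 2) (cube_sq_eq_one hζ) Q) := by
    rw [sq]
    rfl
  rw [hpow]
  cases P with
  | affine a b h =>
    by_cases ha : a = 0
    · simp [fMap', rhoC, ha]
    · have hinv : ((ζ * a) ^ 2)⁻¹ = ζ ^ 2 * (ζ ^ 2 * (a ^ 2)⁻¹) := by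
        field_simp
        linear_combination -hζ.pow_eq_one
      simp only [fMap', rhoC, ha, hζ₀, mul_eq_zero, or_self, dif_neg, not_false_eq_true,
        rho3_ePoint, neg_ePoint]
      simp [mul_pow, hζ₃, div_neg, ← hinv]
  | infty s h =>
    simp only [fMap', rhoC, rho3_ePoint, neg_ePoint]
    simp [hζ₃, div_neg]

end

end SexticJacobian

end

theorem mainTheorem11 (p : ℕ) [Fact p.Prime] [Fact (p ≠ 2)] [Fact (p % 3 = 2)]
    (ζ₆ : Fbar p) (hζ₆ : IsPrimitiveRoot ζ₆ 6) :
    -- The pull-backs of points by `f` and `f'` are well defined.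
    (∀ P, IsPullback (fMap p) (xFun p ^ 2) (yFun p) P (fPull P)) ∧
    (∀ P, IsPullback (fMap' p) (1 / xFun p ^ 2) (yFun p / xFun p ^ 3) P (fPull' P)) ∧
    -- The homomorphisms `μ`, `μ̃` and the endomorphisms `π_C`, `χ`, `ρ₆` of `Jac(C)` are well
    -- defined: they are given by the following formulas.
    (∀ R, ∃ h : muDivisor R ∈ DivisorZero p,
      mu p R = QuotientAddGroup.mk ⟨muDivisor R, h⟩) ∧
    (∀ D : DivisorZero p, muTilde p (QuotientAddGroup.mk D) = muTildeDivisor p D) ∧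
    (∀ D : DivisorZero p, piJac p (QuotientAddGroup.mk D) =
      QuotientAddGroup.mk (pushDivisor (frobC p) D)) ∧
    (∀ D : DivisorZero p, chiJac p (QuotientAddGroup.mk D) =
      QuotientAddGroup.mk (pushDivisor (chiC p) D)) ∧
    (∀ D : DivisorZero p, rho6Jac ζ₆ hζ₆.pow_eq_one (QuotientAddGroup.mk D) =
      QuotientAddGroup.mk (pushDivisor (rhoC ζ₆ hζ₆.pow_eq_one) D)) ∧
    -- The images of `π_C`, `χ` and `ρ₆` under `T`; here `ζ₃ = ζ₆ ^ 2`.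
    T p (piJac p) = 2 • matrixEnd !![piE p, 0; 0, piE p] ∧
    T p (chiJac p) = 2 • matrixEnd !![0, 1; 1, 0] ∧
    T p (rho6Jac ζ₆ hζ₆.pow_eq_one) =
      2 • matrixEnd !![rho3 p (ζ₆ ^ 2) (cube_sq_eq_one hζ₆), 0;
        0, -(rho3 p (ζ₆ ^ 2) (cube_sq_eq_one hζ₆)) ^ 2] := by
  refine ⟨isPullback_fPull, isPullback_fPull', fun R => ⟨muDivisor_mem R, mu_apply R⟩, muTilde_mk,
    inducedEnd_mk fun _ => mapDomain_frobC_mem_principal,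
    inducedEnd_mk fun _ => mapDomain_chiC_mem_principal,
    inducedEnd_mk fun _ => mapDomain_rhoC_mem_principal _, ?_, ?_, ?_⟩
  · refine T_inducedEnd (fun _ => mapDomain_frobC_mem_principal) fun P => ?_
    rw [fMap_frobC, fMap'_frobC]
    simp [matrixEnd_apply]
  · refine T_inducedEnd (fun _ => mapDomain_chiC_mem_principal) fun P => ?_
    rw [fMap_chiC, fMap'_chiC]
    simp [matrixEnd_apply]
  · refine T_inducedEnd (fun _ => mapDomain_rhoC_mem_principal _) fun P => ?_
    rw [fMap_rhoC hζ₆, fMap'_rhoC hζ₆]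
    simp [matrixEnd_apply]
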